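/- There exist numerical constants $C_1, C_2 > 0$ such that the following holds for every dimension $d$. Let $U:\mathbb{R}^d\to\mathbb{R}$ be twice continuously differentiable, with a global minimum at $0$ and $U(0)=0$, and let $L>0$, $L_H\ge 0$ be such that $|\nabla U(x)-\nabla U(y)|\le L|x-y|$ and $\|\nabla^2U(x)-\nabla^2U(y)\|\le L_H|x-y|$ for all $x,y\in\mathbb{R}^d$ (with $\|\cdot\|$ the operator norm). Write $\mathbf F=-\nabla U$ and $\|(x,v)\|_{\mathsf w}=(|x|^2+L^{-1}|v|^2)^{1/2}$. Let $\gamma>0$, let $T>0$ satisfy $LT^2\le 1/4$, let $h>0$ satisfy $T/h\in\mathbb{Z}$, and put $t_k=kh$. Let $\varphi_h$ be the time-$h$ map of the Hamiltonian flow $\dot q=v$, $\dot v=\mathbf F(q)$. For $\mathsf u\in[0,1]$ let $\Theta_h(\mathsf u)$ be the 5/2-order randomized Runge–Kutta–Nyström (rRKN 2.5) map $$\Theta_h(\mathsf u)(x,v)=\Big(x+hv+\tfrac{h^2}{2}\mathbf F^-+\tfrac{h^2}{6\mathsf u}(\mathbf F^+-\mathbf F^-),\; v+h\mathbf F^-+\tfrac{h}{2\mathsf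 u}(\mathbf F^+-\mathbf F^-)\Big),$$ where $\mathbf F^-=\mathbf F(x)$ and $\mathbf F^+=\mathbf F\big(x+\mathsf u h v+\tfrac12(\mathsf u h)^2\mathbf F^-\big)$. For $\mathsf b\in\mathbb{R}^d$ let $O_h(\mathsf b)(x,v)=(x,e^{-\gamma h}v+(1-e^{-2\gamma h})^{1/2}\mathsf b)$ be the exact Ornstein–Uhlenbeck velocity step. Let $(\xi_i)_{i\ge0}$ be i.i.d. $\mathcal N(0,I_d)$ and, independent of them, let $(\mathcal U_i)_{i\ge0}$ be i.i.d. with density $2\mathsf x$ on $[0,1]$. For $z\in\mathbb{R}^{2d}$ define the unadjusted kinetic Langevin chain and the exact splitting by $Z^u_0=Z^e_0=z$ and $$Z^u_{t_{i+1}}=O_h(\xi_i)\circ\Theta_h(\mathcal U_i)(Z^u_{t_i}),\qquad Z^e_{t_{i+1}}=O_h(\xi_i)\circ\varphi_h(Z^e_{t_i}).$$ Then, for every $z\in\mathbb{R}^{2d}$, the expectations below are finite and $$\max_{t_k\le T}\Big(E\big[\|Z^u_{t_k}-Z^e_{t_k}\|_{\mathsf w}^2\big]\Big)^{1/2}\le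 \tfrac32 e^{5/2}(L^{1/2}h)^{5/2}\Big(\|z\|_{\mathsf w}+\gamma^{1/2}L^{-1/2}d^{1/2}C_1^{1/2}\sqrt{\tfrac{e^{2\gamma T}-1}{2\gamma}}\Big)$$ $$\qquad+14\sqrt2\,e^{5/2}L^{1/2}\frac{L_Hh^3}{L^{1/4}h^{1/2}}\Big(\|z\|_{\mathsf w}^2+2\gamma L^{-1}d\,C_2^{1/2}T^{1/2}\sqrt{\tfrac{e^{4\gamma T}-1}{4\gamma}}\Big).$$ -/

import Mathlib

open MeasureTheory ProbabilityTheory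

noncomputable section

namespace KineticLangevin

variable {E : Type*} [NormedAddCommGroup E] [InnerProductSpace ℝ E] [CompleteSpace E]

/-- The squared weighted norm `|x|² + L⁻¹ |v|²` on phase space. -/
def wnormSq (L : ℝ) (z : E × E) : ℝ := ‖z.1‖ ^ 2 + L⁻¹ * ‖z.2‖ ^ 2

/-- The weighted norm `(|x|² + L⁻¹ |v|²)^{1/2}` on phase space. -/
def wnorm (L : ℝ) (z : E × E) : ℝ := Real.sqrt (wnormSq L z)

/-- The force `F = -∇U`. -/
def force (U : E → ℝ) (x : E) : E := -gradient U x

/-- The vector field `(x, v) ↦ (v, F(x))` of Hamilton's equations. -/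
def hamField (U : E → ℝ) (z : E × E) : E × E := (z.2, force U z.1)

open Classical in
/-- The exact Hamiltonian flow `φ_t(x, v)`: the time-`t` value of the solution of
`q' = v`, `v' = F(q)` with `(q_0, v_0) = z`. The fallback value `z` is used only when
there is no global solution started at `z`; for a potential with Lipschitz gradient the solution
exists and is unique. -/
def hamFlow (U : E → ℝ) (t : ℝ) (z : E × E) : E × E :=
  if hz : ∃ c : ℝ → E × E, c 0 = z ∧ ∀ s : ℝ, HasDerivAt c (hamField U (c s)) s
  then hz.choose t else z

/-- The flow map `Θ_h(u)` of the 5/2-order randomized Runge-Kutta-Nyström scheme: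
`F⁻ = F(x)`, `F⁺ = F(x + u h v + (1/2) (u h)² F⁻)`. -/
def rrknStep (U : E → ℝ) (h u : ℝ) (z : E × E) : E × E :=
  let Fm : E := force U z.1
  let Fp : E := force U (z.1 + (u * h) • z.2 + ((1 / 2) * (u * h) ^ 2) • Fm)
  (z.1 + h • z.2 + (h ^ 2 / 2) • Fm + (h ^ 2 / (6 * u)) • (Fp - Fm),
    z.2 + h • Fm + (h / (2 * u)) • (Fp - Fm))

/-- The exact Ornstein-Uhlenbeck velocity map
`O_h(b)(x, v) = (x, e^{-γ h} v + (1 - e^{-2 γ h})^{1/2} b)`. -/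
def ouStep (γ h : ℝ) (b : E) (z : E × E) : E × E :=
  (z.1, Real.exp (-γ * h) • z.2 + Real.sqrt (1 - Real.exp (-2 * γ * h)) • b)

/-- The unadjusted kinetic Langevin chain, driven by `u` and `b`:
`Z_{i+1} = O_h(b_i) (Θ_h(u_i) (Z_i))`. -/
def ukLaChain (U : E → ℝ) (γ h : ℝ) (u : ℕ → ℝ) (b : ℕ → E) (z : E × E) : ℕ → E × E
  | 0 => z
  | i + 1 => ouStep γ h (b i) (rrknStep U h (u i) (ukLaChain U γ h u b z i))

/-- The exact splitting, driven by `b`: `Z_{i+1} = O_h(b_i) (φ_h (Z_i))`. -/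
def exactChain (U : E → ℝ) (γ h : ℝ) (b : ℕ → E) (z : E × E) : ℕ → E × E
  | 0 => z
  | i + 1 => ouStep γ h (b i) (hamFlow U h (exactChain U γ h b z i))

/-- The triangular distribution on `[0, 1]` with mode at `1`, of density `x ↦ 2 x`. -/
def triangular : Measure ℝ :=
  (volume.restrict (Set.Icc (0 : ℝ) 1)).withDensity fun x => ENNReal.ofReal (2 * x)

end KineticLangevin

end

/-! Write `σ = √L`. In the weighted norm the Hamiltonian field is `σ`-Lipschitz, so the exact flow
expands distances by at most `exp (σ t)`. The Ornstein-Uhlenbeck step, driven by the same Gaussian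
in both chains, never expands them. Only the local error of the randomized step therefore matters,
and it has two sizes.

Pathwise it is of order `h ^ 3`: to first order the force increment at time `u h` is `u h` times a
slope, the factors `h / (2 u)` and `h ^ 2 / (6 u)` remove the dependence on `u`, and the result
agrees with the exact flow. In the mean it is of order `h ^ 4`: the density `2 u` cancels `1 / u`,
so the average velocity increment is exactly the integral of the force along the quadratic
predictor, which lies within `O(h ^ 3)` of the true path. The average position increment uses `h /
3` times that integral, which is correct for linear force increments; the Lipschitz Hessian controls
the rest.

Since each `𝒰 k` is independent of both chains up to time `k`, expanding the squared error gives a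
cross term that sees only the small mean. Young's inequality absorbs it into a growth factor `exp (3
σ h)` (`integral_wnorm_rrknStep_sub_hamFlow_sq_le`). Summing `k ≤ T / h` local mean-square errors of
order `h ^ 6` gives `h ^ 5`, hence root-mean-square order `5 / 2`.

The Hessian part of the local error is quadratic in the state, so second and fourth moments of the
numerical chain are needed (`moments_ukLaChain`). They grow by `exp (6 σ h)` and by a noise term per
step. Finally `σ T ≤ 1 / 2` bounds all exponentials, and `rpow_half_error_le` matches the result to
the stated form. -/

noncomputable section

namespace KineticLangevin

open scoped NNReal
open Set

/-! ### The exact Hamiltonian flow in the weighted norm -/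

section

open scoped Manifold

/-- A globally Lipschitz `C¹` vector field has a global integral curve through every point. -/
theorem exists_global_solution {V : Type*} [NormedAddCommGroup V] [NormedSpace ℝ V]
    [CompleteSpace V] {f : V → V} (hf : ContDiff ℝ 1 f) {K : ℝ≥0} (hK : LipschitzWith K f) (z : V) :
    ∃ c : ℝ → V, c 0 = z ∧ ∀ s : ℝ, HasDerivAt c (f (c s)) s := by
  have hsec : ContMDiff 𝓘(ℝ, V) (𝓘(ℝ, V).tangent) 1
      (fun x ↦ (⟨x, f x⟩ : TangentBundle 𝓘(ℝ, V) V)) :=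
    contMDiff_vectorSpace_iff_contDiff.2 hf
  have hε : (0 : ℝ) < 1 / (1 + K) := by positivity
  obtain ⟨c, hc0, hc⟩ := exists_isMIntegralCurve_of_isMIntegralCurveOn (I := 𝓘(ℝ, V)) (v := f)
    hsec hε (fun x ↦ by
    -- On the ball of radius `‖f x‖ + 1` the speed is at most `(1 + K) * (‖f x‖ + 1)`, so the time
    -- `1 / (1 + K)` works for every starting point. This uniformity is what allows local curves to
    -- be continued globally.
    have hpl : IsPicardLindelof (fun _ ↦ f) (tmin := -(1 / (1 + K))) (tmax := 1 / (1 + K))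
        ⟨0, by constructor <;> [linarith; linarith]⟩ x (‖f x‖₊ + 1) 0
        (‖f x‖₊ + K * (‖f x‖₊ + 1)) K := by
      apply IsPicardLindelof.of_time_independent
      · intro y hy
        have h1 := hK.dist_le_mul y x
        rw [Metric.mem_closedBall] at hy
        rw [dist_eq_norm] at h1
        calc ‖f y‖ ≤ ‖f x‖ + ‖f y - f x‖ := by
              simpa using norm_add_le (f x) (f y - f x)
          _ ≤ ‖f x‖ + K * (‖f x‖ + 1) := by
              gcongr
              exact h1.trans (by gcongr; exact_mod_cast hy)
          _ = _ := by push_cast; simp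
      · exact hK.lipschitzOnWith
      · simp only [sub_zero, zero_sub, neg_neg, max_self]
        push_cast
        rw [mul_one_div, div_le_iff₀ (by positivity)]
        simp
        nlinarith [norm_nonneg (f x), K.2]
    obtain ⟨α, hα0, hα⟩ := hpl.exists_eq_forall_mem_Icc_hasDerivWithinAt₀
    refine ⟨α, hα0, fun t ht ↦ ?_⟩
    have h1 := (hα t ⟨ht.1.le, ht.2.le⟩).mono Ioo_subset_Icc_self
    exact h1.hasFDerivWithinAt.hasMFDerivWithinAt) z
  refine ⟨c, hc0, fun s ↦ ?_⟩
  have h : HasFDerivAt c ((1 : ℝ →L[ℝ] ℝ).smulRight (f (c s))) s := (hc s).hasFDerivAt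
  simpa using h.hasDerivAt

section Norm

variable {E : Type*} [NormedAddCommGroup E]

theorem wnormSq_nonneg (σ : ℝ) (z : E × E) : 0 ≤ wnormSq (σ ^ 2) z := by
  unfold wnormSq; positivity

theorem wnorm_nonneg (L : ℝ) (z : E × E) : 0 ≤ wnorm L z := Real.sqrt_nonneg _

theorem wnorm_sq (σ : ℝ) (z : E × E) : wnorm (σ ^ 2) z ^ 2 = wnormSq (σ ^ 2) z :=
  Real.sq_sqrt (wnormSq_nonneg σ z)

theorem continuous_wnorm (L : ℝ) : Continuous (wnorm L : E × E → ℝ) := by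
  unfold wnorm wnormSq; fun_prop

theorem norm_fst_le_wnorm (σ : ℝ) (z : E × E) : ‖z.1‖ ≤ wnorm (σ ^ 2) z := by
  apply Real.le_sqrt_of_sq_le
  unfold wnormSq
  have : 0 ≤ (σ ^ 2)⁻¹ * ‖z.2‖ ^ 2 := by positivity
  linarith

theorem norm_snd_le_wnorm {σ : ℝ} (hσ : 0 < σ) (z : E × E) : ‖z.2‖ ≤ σ * wnorm (σ ^ 2) z := by
  rw [← div_le_iff₀' hσ]
  apply Real.le_sqrt_of_sq_le
  unfold wnormSq
  have : (‖z.2‖ / σ) ^ 2 = (σ ^ 2)⁻¹ * ‖z.2‖ ^ 2 := by rw [div_pow]; ring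
  nlinarith [sq_nonneg ‖z.1‖]

theorem wnorm_le_add {σ : ℝ} (hσ : 0 < σ) (z : E × E) :
    wnorm (σ ^ 2) z ≤ ‖z.1‖ + σ⁻¹ * ‖z.2‖ := by
  apply Real.sqrt_le_iff.2 ⟨by positivity, ?_⟩
  unfold wnormSq
  have : 0 ≤ ‖z.1‖ * (σ⁻¹ * ‖z.2‖) := by positivity
  rw [add_sq, mul_pow, inv_pow]
  linarith

end Norm

variable {E : Type*} [NormedAddCommGroup E] [InnerProductSpace ℝ E]

/-- The linear embedding of phase space that turns the weighted norm with `L = σ²` into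
the Hilbert norm. -/
def weightedEmb (E : Type*) [NormedAddCommGroup E] [InnerProductSpace ℝ E] (σ : ℝ) :
    E × E →L[ℝ] WithLp 2 (E × E) :=
  ((WithLp.prodContinuousLinearEquiv 2 ℝ E E).symm : E × E →L[ℝ] WithLp 2 (E × E)) ∘L
    ((ContinuousLinearMap.id ℝ E).prodMap (σ⁻¹ • ContinuousLinearMap.id ℝ E))

theorem norm_weightedEmb (σ : ℝ) (z : E × E) : ‖weightedEmb E σ z‖ = wnorm (σ ^ 2) z := by
  rw [WithLp.prod_norm_eq_of_L2, wnorm, wnormSq]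
  simp [weightedEmb, norm_smul, mul_pow]

theorem wnorm_add_le (σ : ℝ) (z w : E × E) :
    wnorm (σ ^ 2) (z + w) ≤ wnorm (σ ^ 2) z + wnorm (σ ^ 2) w := by
  simp only [← norm_weightedEmb, map_add]
  exact norm_add_le _ _

variable [CompleteSpace E]

/-- The force vanishes at the origin, is `C¹` and `σ²`-Lipschitz, and its derivative is
`M`-Lipschitz. -/
structure RegularForce (U : E → ℝ) (σ M : ℝ) : Prop where
  contDiff : ContDiff ℝ 1 (force U)
  zero : force U 0 = 0
  lipschitz : ∀ x y, ‖force U x - force U y‖ ≤ σ ^ 2 * ‖x - y‖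
  deriv_lipschitz : ∀ x y, ‖fderiv ℝ (force U) x - fderiv ℝ (force U) y‖ ≤ M * ‖x - y‖

theorem RegularForce.of_potential {U : E → ℝ} {L M : ℝ} (hL : 0 < L) (hU : ContDiff ℝ 2 U)
    (hmin : ∀ x, U 0 ≤ U x)
    (hlip : ∀ x y, ‖gradient U x - gradient U y‖ ≤ L * ‖x - y‖)
    (hH : ∀ x y, ‖fderiv ℝ (gradient U) x - fderiv ℝ (gradient U) y‖ ≤ M * ‖x - y‖) :
    RegularForce U (√L) M where
  contDiff := by
    have h : ContDiff ℝ 1 (fderiv ℝ U) := hU.fderiv_right (by norm_num)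
    exact ((InnerProductSpace.toDual ℝ E).symm.toContinuousLinearEquiv.contDiff.comp h).neg
  zero := by
    have h : IsLocalMin U 0 := Filter.Eventually.of_forall hmin
    simp [force, gradient, h.fderiv_eq_zero]
  lipschitz x y := by
    rw [Real.sq_sqrt hL.le, force, force, neg_sub_neg, norm_sub_rev]
    exact hlip x y
  deriv_lipschitz x y := by
    have h : force U = fun x ↦ -gradient U x := rfl
    rw [h, fderiv_fun_neg, fderiv_fun_neg, neg_sub_neg, norm_sub_rev]
    exact hH x y

namespace RegularForce

variable {U : E → ℝ} {σ M : ℝ}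

theorem continuous (hF : RegularForce U σ M)
    : Continuous (force U) := hF.contDiff.continuous

theorem norm_le (hF : RegularForce U σ M)
    (x : E) : ‖force U x‖ ≤ σ ^ 2 * ‖x‖ := by
  simpa [hF.zero] using hF.lipschitz x 0

/-- The weight `σ⁻²` on velocities balances the two components: each is stretched by exactly `σ` at
worst. This is why all later estimates depend on `σ h` alone. -/
theorem wnorm_hamField_sub_le (hF : RegularForce U σ M)
    (hσ : 0 < σ) (z w : E × E) :
    wnorm (σ ^ 2) (hamField U z - hamField U w) ≤ σ * wnorm (σ ^ 2) (z - w) := by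
  rw [wnorm, wnorm, ← Real.sqrt_sq hσ.le, ← Real.sqrt_mul (sq_nonneg _), Real.sqrt_sq hσ.le]
  apply Real.sqrt_le_sqrt
  have h := pow_le_pow_left₀ (norm_nonneg _) (hF.lipschitz z.1 w.1) 2
  have h' : (σ ^ 2)⁻¹ * ‖force U z.1 - force U w.1‖ ^ 2 ≤ σ ^ 2 * ‖z.1 - w.1‖ ^ 2 := by
    rw [inv_mul_le_iff₀ (by positivity)]
    calc _ ≤ _ := h
      _ = _ := by ring
  simp only [wnormSq, hamField, Prod.fst_sub, Prod.snd_sub]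
  rw [mul_add, mul_inv_cancel_left₀ (by positivity)]
  linarith

/-- Only existence and uniqueness of the flow use this sup-norm constant; quantitative bounds come
from the weighted norm. -/
theorem lipschitzWith_hamField (hF : RegularForce U σ M) :
    LipschitzWith (1 + (σ ^ 2).toNNReal) (hamField U) := by
  apply LipschitzWith.of_dist_le_mul
  intro z w
  rw [dist_eq_norm, dist_eq_norm]
  have h1 := norm_fst_le (z - w)
  have h2 := norm_snd_le (z - w)
  have h3 := hF.lipschitz z.1 w.1
  have h4 : σ ^ 2 * ‖z.1 - w.1‖ ≤ σ ^ 2 * ‖z - w‖ := by gcongr; exact h1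
  have h5 : 0 ≤ σ ^ 2 * ‖z - w‖ := by positivity
  rw [NNReal.coe_add, NNReal.coe_one, Real.coe_toNNReal _ (sq_nonneg σ)]
  rw [Prod.norm_def, sup_le_iff]
  simp only [hamField, Prod.fst_sub, Prod.snd_sub] at *
  constructor <;> linarith [norm_nonneg (z - w)]

theorem hamFlow_spec (hF : RegularForce U σ M)
    (z : E × E) :
    hamFlow U 0 z = z ∧ ∀ s, HasDerivAt (fun t ↦ hamFlow U t z) (hamField U (hamFlow U s z)) s := by
  have hz : ∃ c : ℝ → E × E, c 0 = z ∧ ∀ s : ℝ, HasDerivAt c (hamField U (c s)) s := by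
    refine exists_global_solution ?_ hF.lipschitzWith_hamField z
    exact contDiff_snd.prodMk (hF.contDiff.comp contDiff_fst)
  have h : ∀ t, hamFlow U t z = hz.choose t := fun t ↦ by rw [hamFlow, dif_pos hz]
  simp only [h]
  exact hz.choose_spec

theorem wnorm_hamFlow_sub_le (hF : RegularForce U σ M)
    (hσ : 0 < σ) {t : ℝ} (ht : 0 ≤ t) (z w : E × E) :
    wnorm (σ ^ 2) (hamFlow U t z - hamFlow U t w) ≤ Real.exp (σ * t) * wnorm (σ ^ 2) (z - w) := by
  obtain ⟨hz0, hz⟩ := hF.hamFlow_spec z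
  obtain ⟨hw0, hw⟩ := hF.hamFlow_spec w
  have hd : ∀ s, HasDerivAt (fun t ↦ weightedEmb E σ (hamFlow U t z - hamFlow U t w))
      (weightedEmb E σ (hamField U (hamFlow U s z) - hamField U (hamFlow U s w))) s := fun s ↦
    (weightedEmb E σ).hasFDerivAt.comp_hasDerivAt s ((hz s).sub (hw s))
  have h := norm_le_gronwallBound_of_norm_deriv_right_le (a := 0) (b := t) (K := σ) (ε := 0)
    (fun s _ ↦ (hd s).continuousAt.continuousWithinAt) (fun s _ ↦ (hd s).hasDerivWithinAt)
    (δ := wnorm (σ ^ 2) (z - w)) (by simp only [hz0, hw0, norm_weightedEmb]; exact le_rfl)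
    (fun s _ ↦ by
      rw [norm_weightedEmb, norm_weightedEmb, add_zero]
      exact hF.wnorm_hamField_sub_le hσ _ _) t ⟨ht, le_rfl⟩
  rw [norm_weightedEmb, gronwallBound_ε0, sub_zero] at h
  linarith

/-- The minimum is an equilibrium, so the stability estimate, applied against the origin, becomes a
growth bound. -/
theorem hamFlow_zero (hF : RegularForce U σ M)
    (t : ℝ) : hamFlow U t (0 : E × E) = 0 := by
  obtain ⟨h0, h⟩ := hF.hamFlow_spec 0
  have hc : ∀ s : ℝ, HasDerivAt (fun _ : ℝ ↦ (0 : E × E)) (hamField U 0) s := fun s ↦ by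
    have : hamField U (0 : E × E) = 0 := by simp [hamField, hF.zero]
    rw [this]; exact hasDerivAt_const _ _
  have := ODE_solution_unique_univ (v := fun _ ↦ hamField U) (s := fun _ ↦ univ) (t₀ := 0)
    (f := fun t ↦ hamFlow U t 0) (g := fun _ ↦ 0)
    (fun _ ↦ hF.lipschitzWith_hamField.lipschitzOnWith) (fun t ↦ ⟨h t, trivial⟩)
    (fun t ↦ ⟨hc t, trivial⟩) h0
  exact congrFun this t

theorem wnorm_hamFlow_le (hF : RegularForce U σ M)
    (hσ : 0 < σ) {t : ℝ} (ht : 0 ≤ t) (z : E × E) :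
    wnorm (σ ^ 2) (hamFlow U t z) ≤ Real.exp (σ * t) * wnorm (σ ^ 2) z := by
  simpa [hF.hamFlow_zero t] using hF.wnorm_hamFlow_sub_le hσ ht z 0

theorem continuous_hamFlow (hF : RegularForce U σ M)
    (hσ : 0 < σ) {t : ℝ} (ht : 0 ≤ t) : Continuous (hamFlow U t) := by
  rw [continuous_iff_continuousAt]
  intro z
  rw [ContinuousAt, tendsto_iff_norm_sub_tendsto_zero]
  have hlim : Filter.Tendsto (fun w ↦ (1 + σ) * (Real.exp (σ * t) * wnorm (σ ^ 2) (w - z)))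
      (nhds z) (nhds 0) := by
    have : Continuous fun w ↦ (1 + σ) * (Real.exp (σ * t) * wnorm (σ ^ 2) (w - z)) := by
      have := continuous_wnorm (E := E) (σ ^ 2)
      fun_prop
    simpa [wnorm, wnormSq] using this.tendsto z
  refine squeeze_zero (fun _ ↦ norm_nonneg _) (fun w ↦ ?_) hlim
  have h := hF.wnorm_hamFlow_sub_le hσ ht w z
  have h1 := norm_fst_le_wnorm σ (hamFlow U t w - hamFlow U t z)
  have h2 := norm_snd_le_wnorm hσ (hamFlow U t w - hamFlow U t z)
  have h3 := wnorm_nonneg (σ ^ 2) (hamFlow U t w - hamFlow U t z)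
  calc _ ≤ (1 + σ) * wnorm (σ ^ 2) (hamFlow U t w - hamFlow U t z) := by
        rw [Prod.norm_def, sup_le_iff]; constructor <;> nlinarith
    _ ≤ _ := by gcongr

end RegularForce

end

/-! ### Deterministic expansions along the quadratic predictor -/

section

/-- A curve starting at `0` whose speed is at most `C s ^ k` has norm at most
`C / (k + 1) s ^ (k + 1)`. -/
theorem norm_le_of_norm_deriv_le_pow {V : Type*} [NormedAddCommGroup V] [NormedSpace ℝ V]
    {f f' : ℝ → V} {h C : ℝ} (k : ℕ) (h0 : f 0 = 0) (hd : ∀ s, HasDerivAt f (f' s) s)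
    (hb : ∀ s, 0 ≤ s → s ≤ h → ‖f' s‖ ≤ C * s ^ k) (hh : 0 ≤ h) :
    ‖f h‖ ≤ C / (k + 1) * h ^ (k + 1) := by
  have hB : ∀ s : ℝ, HasDerivAt (fun s ↦ C / (k + 1) * s ^ (k + 1)) (C * s ^ k) s := fun s ↦ by
    have := (hasDerivAt_pow (k + 1) s).const_mul (C / (k + 1))
    convert! this using 1
    have : (k : ℝ) + 1 ≠ 0 := by positivity
    push_cast
    field_simp
  exact image_norm_le_of_norm_deriv_right_le_deriv_boundary (a := 0) (b := h)
    (fun s _ ↦ (hd s).continuousAt.continuousWithinAt)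
    (fun s _ ↦ (hd s).hasDerivWithinAt) (by simp [h0]) hB (fun s hs ↦ hb s hs.1 hs.2.le)
    ⟨hh, le_rfl⟩

variable {E : Type*} [NormedAddCommGroup E] [InnerProductSpace ℝ E] [CompleteSpace E]

/-- The quadratic predictor `x + r v + r² F(x) / 2` of the position at time `r`. -/
def predictor (U : E → ℝ) (z : E × E) (r : ℝ) : E :=
  z.1 + r • z.2 + ((1 / 2) * r ^ 2) • force U z.1

/-- The increment of the force along the quadratic predictor. -/
def forceIncr (U : E → ℝ) (z : E × E) (r : ℝ) : E := force U (predictor U z r) - force U z.1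

/-- The derivative of the force at the starting point in the direction of the velocity. -/
def forceSlope (U : E → ℝ) (z : E × E) : E := fderiv ℝ (force U) z.1 z.2

theorem rrknStep_eq (U : E → ℝ) (h u : ℝ) (z : E × E) :
    rrknStep U h u z =
      (z.1 + h • z.2 + (h ^ 2 / 2) • force U z.1 + (h ^ 2 / (6 * u)) • forceIncr U z (u * h),
        z.2 + h • force U z.1 + (h / (2 * u)) • forceIncr U z (u * h)) := rfl

theorem hasDerivAt_predictor (U : E → ℝ) (z : E × E) (r : ℝ) :
    HasDerivAt (predictor U z) (z.2 + r • force U z.1) r := by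
  have h1 : HasDerivAt (fun r : ℝ ↦ r • z.2) ((1 : ℝ) • z.2) r :=
    (hasDerivAt_id r).smul_const _
  have h2 : HasDerivAt (fun r : ℝ ↦ ((1 / 2) * r ^ 2) • force U z.1)
      (((1 / 2) * (2 * r)) • force U z.1) r := by
    apply HasDerivAt.smul_const
    simpa using (hasDerivAt_pow 2 r).const_mul (1 / 2 : ℝ)
  have := (h1.const_add z.1).add h2
  convert! this using 1
  rw [one_smul]; congr 2; ring

namespace RegularForce

variable {U : E → ℝ} {σ M : ℝ}

theorem continuous_forceIncr (hF : RegularForce U σ M)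
    (z : E × E) : Continuous (forceIncr U z) := by
  have := hF.continuous
  unfold forceIncr predictor
  fun_prop

/-- Second-order Taylor remainder: along the segment from `x` to `x + y` the remainder has speed at
most `M * ‖y‖ ^ 2 * s`. -/
theorem norm_sub_sub_fderiv_le (hF : RegularForce U σ M)
    (x y : E) :
    ‖force U (x + y) - force U x - fderiv ℝ (force U) x y‖ ≤ M / 2 * ‖y‖ ^ 2 := by
  have hd : ∀ s : ℝ, HasDerivAt
      (fun s : ℝ ↦ force U (x + s • y) - force U x - s • fderiv ℝ (force U) x y)
      (fderiv ℝ (force U) (x + s • y) y - fderiv ℝ (force U) x y) s := fun s ↦ by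
    have h1 : HasDerivAt (fun s : ℝ ↦ x + s • y) y s := by
      simpa using ((hasDerivAt_id s).smul_const y).const_add x
    have h2 := ((hF.contDiff.differentiable (by norm_num)) (x + s • y)).hasFDerivAt.comp_hasDerivAt
      s h1
    have h3 : HasDerivAt (fun s : ℝ ↦ s • fderiv ℝ (force U) x y)
      (fderiv ℝ (force U) x y) s := by simpa using (hasDerivAt_id s).smul_const _
    exact (h2.sub_const _).sub h3
  have h := norm_le_of_norm_deriv_le_pow (C := M * ‖y‖ ^ 2) (h := 1) 1 (by simp) hd
    (fun s hs _ ↦ by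
      rw [← sub_apply]
      refine (ContinuousLinearMap.le_opNorm _ _).trans ?_
      have := hF.deriv_lipschitz (x + s • y) x
      rw [add_sub_cancel_left, norm_smul, Real.norm_of_nonneg hs] at this
      calc _ ≤ M * (s * ‖y‖) * ‖y‖ := by gcongr
        _ = _ := by ring) zero_le_one
  simp only [one_smul] at h
  refine h.trans (le_of_eq ?_)
  push_cast; ring

theorem norm_fderiv_le (hF : RegularForce U σ M)
    (x : E) : ‖fderiv ℝ (force U) x‖ ≤ σ ^ 2 := by
  have h : LipschitzWith (σ ^ 2).toNNReal (force U) := by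
    apply LipschitzWith.of_dist_le_mul
    intro x y
    rw [dist_eq_norm, dist_eq_norm, Real.coe_toNNReal _ (sq_nonneg σ)]
    exact hF.lipschitz x y
  exact (norm_fderiv_le_of_lipschitz ℝ h (x₀ := x)).trans_eq (Real.coe_toNNReal _ (sq_nonneg σ))

theorem hasDerivAt_integral_forceIncr (hF : RegularForce U σ M)
    (z : E × E) (r : ℝ) :
    HasDerivAt (fun r ↦ ∫ s in (0 : ℝ)..r, forceIncr U z s) (forceIncr U z r) r :=
  intervalIntegral.integral_hasDerivAt_right ((hF.continuous_forceIncr z).intervalIntegrable _ _)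
    (hF.continuous_forceIncr z).stronglyMeasurable.stronglyMeasurableAtFilter
    (hF.continuous_forceIncr z).continuousAt

section Local

theorem norm_hamFlow_snd_le (hF : RegularForce U σ M) (hσ : 0 < σ) (z : E × E)
    {r : ℝ} (hr : 0 ≤ r) (hr' : σ * r ≤ 1 / 2) :
    ‖(hamFlow U r z).2‖ ≤ 2 * σ * wnorm (σ ^ 2) z := by
  have h1 := norm_snd_le_wnorm hσ (hamFlow U r z)
  have h2 := hF.wnorm_hamFlow_le hσ hr z
  have h3 : Real.exp (σ * r) ≤ 2 := by
    have h4 : Real.exp (σ * r) ≤ Real.exp (1 / 2) := Real.exp_le_exp.2 hr'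
    have h5 : Real.exp (1 / 2) ^ 2 = Real.exp 1 := by rw [← Real.exp_nat_mul]; norm_num
    nlinarith [Real.exp_one_lt_d9, Real.exp_pos (1 / 2)]
  have h4 := wnorm_nonneg (σ ^ 2) z
  calc _ ≤ σ * (2 * wnorm (σ ^ 2) z) := h1.trans (by gcongr; exact h2.trans (by gcongr))
    _ = _ := by ring

/-- Start of a bootstrap: each bound, inserted into one of Hamilton's equations and integrated,
gains one power of `r`, up to the order `r ^ 4` of the mean velocity error. -/
theorem norm_hamFlow_fst_sub_le (hF : RegularForce U σ M) (hσ : 0 < σ) (z : E × E)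
    {r : ℝ} (hr : 0 ≤ r) (hr' : σ * r ≤ 1 / 2) :
    ‖(hamFlow U r z).1 - z.1‖ ≤ 2 * σ * wnorm (σ ^ 2) z * r := by
  obtain ⟨h0, hd⟩ := hF.hamFlow_spec z
  have := norm_le_of_norm_deriv_le_pow (C := 2 * σ * wnorm (σ ^ 2) z) (h := r) 0
    (f := fun s ↦ (hamFlow U s z).1 - z.1) (by simp [h0])
    (fun s ↦ (hasFDerivAt_fst.comp_hasDerivAt s (hd s)).sub_const _)
    (fun s hs hs' ↦ by
      simpa [hamField] using hF.norm_hamFlow_snd_le hσ z hs (le_trans (by gcongr) hr')) hr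
  simpa using this

theorem norm_hamFlow_snd_sub_le (hF : RegularForce U σ M) (hσ : 0 < σ) (z : E × E)
    {r : ℝ} (hr : 0 ≤ r) (hr' : σ * r ≤ 1 / 2) :
    ‖(hamFlow U r z).2 - z.2 - r • force U z.1‖ ≤ σ ^ 3 * wnorm (σ ^ 2) z * r ^ 2 := by
  obtain ⟨h0, hd⟩ := hF.hamFlow_spec z
  have := norm_le_of_norm_deriv_le_pow (C := 2 * σ ^ 3 * wnorm (σ ^ 2) z) (h := r) 1
    (f := fun s ↦ (hamFlow U s z).2 - z.2 - s • force U z.1) (by simp [h0])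
    (fun s ↦ ((hasFDerivAt_snd.comp_hasDerivAt s (hd s)).sub_const _).sub
      ((hasDerivAt_id s).smul_const _))
    (fun s hs hs' ↦ by
      have h1 := hF.norm_hamFlow_fst_sub_le hσ z hs (le_trans (by gcongr) hr')
      have h2 := hF.lipschitz (hamFlow U s z).1 z.1
      simp only [hamField, ContinuousLinearMap.coe_snd', one_smul]
      calc _ ≤ _ := h2
        _ ≤ σ ^ 2 * (2 * σ * wnorm (σ ^ 2) z * s) := by gcongr
        _ = _ := by ring) hr
  refine this.trans (le_of_eq ?_)
  push_cast; ring

theorem norm_hamFlow_fst_sub_predictor_le (hF : RegularForce U σ M) (hσ : 0 < σ) (z : E × E)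
    {r : ℝ} (hr : 0 ≤ r) (hr' : σ * r ≤ 1 / 2) :
    ‖(hamFlow U r z).1 - predictor U z r‖ ≤ σ ^ 3 * wnorm (σ ^ 2) z / 3 * r ^ 3 := by
  obtain ⟨h0, hd⟩ := hF.hamFlow_spec z
  have := norm_le_of_norm_deriv_le_pow (C := σ ^ 3 * wnorm (σ ^ 2) z) (h := r) 2
    (f := fun s ↦ (hamFlow U s z).1 - predictor U z s) (by simp [h0, predictor])
    (fun s ↦ (hasFDerivAt_fst.comp_hasDerivAt s (hd s)).sub (hasDerivAt_predictor U z s))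
    (fun s hs hs' ↦ by
      have h1 := hF.norm_hamFlow_snd_sub_le hσ z hs (le_trans (by gcongr) hr')
      simpa only [hamField, ContinuousLinearMap.coe_fst', sub_sub] using h1) hr
  refine this.trans (le_of_eq ?_)
  push_cast; ring

/-- The mean velocity error of the scheme. -/
theorem norm_hamFlow_snd_sub_integral_le (hF : RegularForce U σ M) (hσ : 0 < σ) (z : E × E)
    {r : ℝ} (hr : 0 ≤ r) (hr' : σ * r ≤ 1 / 2) :
    ‖(hamFlow U r z).2 - z.2 - r • force U z.1 - ∫ s in (0 : ℝ)..r, forceIncr U z s‖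
      ≤ σ ^ 5 * wnorm (σ ^ 2) z / 12 * r ^ 4 := by
  obtain ⟨h0, hd⟩ := hF.hamFlow_spec z
  have := norm_le_of_norm_deriv_le_pow (C := σ ^ 5 * wnorm (σ ^ 2) z / 3) (h := r) 3
    (f := fun s ↦ (hamFlow U s z).2 - z.2 - s • force U z.1 - ∫ t in (0 : ℝ)..s, forceIncr U z t)
    (by simp [h0])
    (fun s ↦ (((hasFDerivAt_snd.comp_hasDerivAt s (hd s)).sub_const _).sub
      ((hasDerivAt_id s).smul_const _)).sub (hF.hasDerivAt_integral_forceIncr z s))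
    (fun s hs hs' ↦ by
      have h1 := hF.norm_hamFlow_fst_sub_predictor_le hσ z hs (le_trans (by gcongr) hr')
      have h2 := hF.lipschitz (hamFlow U s z).1 (predictor U z s)
      simp only [hamField, ContinuousLinearMap.coe_snd', one_smul, forceIncr,
        sub_sub_sub_cancel_right]
      calc _ ≤ _ := h2
        _ ≤ σ ^ 2 * (σ ^ 3 * wnorm (σ ^ 2) z / 3 * s ^ 3) := by gcongr
        _ = _ := by ring) hr
  refine this.trans (le_of_eq ?_)
  push_cast; ring

theorem norm_predictor_sub_le (hF : RegularForce U σ M) (hσ : 0 < σ) (z : E × E)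
    {r : ℝ} (hr : 0 ≤ r) (hr' : σ * r ≤ 1 / 2) :
    ‖predictor U z r - z.1‖ ≤ 5 / 4 * (σ * wnorm (σ ^ 2) z * r) := by
  have h1 := norm_snd_le_wnorm hσ z
  have h2 := norm_fst_le_wnorm σ z
  have h3 := hF.norm_le z.1
  have h4 := wnorm_nonneg (σ ^ 2) z
  have h5 : predictor U z r - z.1 = r • z.2 + ((1 / 2) * r ^ 2) • force U z.1 := by
    unfold predictor; abel
  rw [h5]
  calc _ ≤ r * ‖z.2‖ + ((1 / 2) * r ^ 2) * ‖force U z.1‖ := by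
        refine (norm_add_le _ _).trans (le_of_eq ?_)
        rw [norm_smul, norm_smul, Real.norm_of_nonneg hr, Real.norm_of_nonneg (by positivity)]
    _ ≤ r * (σ * wnorm (σ ^ 2) z) + ((1 / 2) * r ^ 2) * (σ ^ 2 * wnorm (σ ^ 2) z) := by
        gcongr; exact h3.trans (by gcongr)
    _ = σ * wnorm (σ ^ 2) z * r + (1 / 2) * (σ * r) * (σ * wnorm (σ ^ 2) z * r) := by ring
    _ ≤ σ * wnorm (σ ^ 2) z * r + (1 / 2) * (1 / 2) * (σ * wnorm (σ ^ 2) z * r) := by gcongr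
    _ = _ := by ring

theorem norm_forceIncr_le (hF : RegularForce U σ M) (hσ : 0 < σ) (z : E × E)
    {r : ℝ} (hr : 0 ≤ r) (hr' : σ * r ≤ 1 / 2) :
    ‖forceIncr U z r‖ ≤ 5 / 4 * (σ ^ 3 * wnorm (σ ^ 2) z * r) := by
  calc _ ≤ σ ^ 2 * ‖predictor U z r - z.1‖ := hF.lipschitz _ _
    _ ≤ σ ^ 2 * (5 / 4 * (σ * wnorm (σ ^ 2) z * r)) := by
        gcongr; exact hF.norm_predictor_sub_le hσ z hr hr'
    _ = _ := by ring

/-- Two sources of curvature: the Taylor remainder of the force, the only place where `M` enters,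
and the acceleration term of the predictor. -/
theorem norm_forceIncr_sub_slope_le (hF : RegularForce U σ M) (hσ : 0 < σ) (z : E × E)
    (hM : 0 ≤ M) {r : ℝ} (hr : 0 ≤ r) (hr' : σ * r ≤ 1 / 2) :
    ‖forceIncr U z r - r • forceSlope U z‖
      ≤ (σ ^ 4 * wnorm (σ ^ 2) z / 2 + M * σ ^ 2 * wnorm (σ ^ 2) z ^ 2) * r ^ 2 := by
  have h1 := hF.norm_sub_sub_fderiv_le z.1 (predictor U z r - z.1)
  have h2 := hF.norm_predictor_sub_le hσ z hr hr'
  have h3 := hF.norm_fderiv_le z.1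
  have h4 := wnorm_nonneg (σ ^ 2) z
  have h5 := hF.norm_le z.1
  have h6 := norm_fst_le_wnorm σ z
  have h7 : predictor U z r - z.1 = r • z.2 + ((1 / 2) * r ^ 2) • force U z.1 := by
    unfold predictor; abel
  have h8 : forceIncr U z r - r • forceSlope U z =
      (force U (z.1 + (predictor U z r - z.1)) - force U z.1
        - fderiv ℝ (force U) z.1 (predictor U z r - z.1))
        + ((1 / 2) * r ^ 2) • fderiv ℝ (force U) z.1 (force U z.1) := by
    rw [add_sub_cancel, h7, map_add, map_smul, map_smul, forceIncr, forceSlope]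
    abel
  rw [h8]
  calc _ ≤ M / 2 * ‖predictor U z r - z.1‖ ^ 2
        + ((1 / 2) * r ^ 2) * (σ ^ 2 * (σ ^ 2 * wnorm (σ ^ 2) z)) := by
        refine (norm_add_le _ _).trans (_root_.add_le_add h1 ?_)
        rw [norm_smul, Real.norm_of_nonneg (by positivity)]
        gcongr
        refine (ContinuousLinearMap.le_opNorm _ _).trans ?_
        gcongr
        exact h5.trans (by gcongr)
    _ ≤ M / 2 * (5 / 4 * (σ * wnorm (σ ^ 2) z * r)) ^ 2
        + ((1 / 2) * r ^ 2) * (σ ^ 2 * (σ ^ 2 * wnorm (σ ^ 2) z)) := by gcongr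
    -- The coefficient of the `M` term is `25 / 32`, rounded up to `1`.
    _ ≤ _ := by
        have : 0 ≤ M * (σ * wnorm (σ ^ 2) z * r) ^ 2 := by positivity
        nlinarith

theorem norm_integral_forceIncr_sub_slope_le (hF : RegularForce U σ M) (hσ : 0 < σ) (z : E × E)
    (hM : 0 ≤ M) {r : ℝ} (hr : 0 ≤ r)
    (hr' : σ * r ≤ 1 / 2) :
    ‖(∫ s in (0 : ℝ)..r, forceIncr U z s) - (r ^ 2 / 2) • forceSlope U z‖
      ≤ (σ ^ 4 * wnorm (σ ^ 2) z / 2 + M * σ ^ 2 * wnorm (σ ^ 2) z ^ 2) / 3 * r ^ 3 := by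
  have := norm_le_of_norm_deriv_le_pow
    (C := σ ^ 4 * wnorm (σ ^ 2) z / 2 + M * σ ^ 2 * wnorm (σ ^ 2) z ^ 2) (h := r) 2
    (f := fun r ↦ (∫ s in (0 : ℝ)..r, forceIncr U z s) - (r ^ 2 / 2) • forceSlope U z) (by simp)
    (fun s ↦ (hF.hasDerivAt_integral_forceIncr z s).sub
      (((hasDerivAt_pow 2 s).div_const 2).smul_const _))
    (fun s hs hs' ↦ by
      have h1 := hF.norm_forceIncr_sub_slope_le hσ z hM hs (le_trans (by gcongr) hr')
      simpa using h1) hr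
  refine this.trans (le_of_eq ?_)
  push_cast; ring

/-- The mean position error of the scheme. -/
theorem norm_hamFlow_fst_sub_integral_le (hF : RegularForce U σ M) (hσ : 0 < σ) (z : E × E)
    (hM : 0 ≤ M) {r : ℝ} (hr : 0 ≤ r)
    (hr' : σ * r ≤ 1 / 2) :
    ‖(hamFlow U r z).1 - z.1 - r • z.2 - (r ^ 2 / 2) • force U z.1
        - (r / 3) • ∫ s in (0 : ℝ)..r, forceIncr U z s‖
      ≤ (σ ^ 4 * wnorm (σ ^ 2) z / 12 + M * σ ^ 2 * wnorm (σ ^ 2) z ^ 2 * (5 / 36)) * r ^ 4 := by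
  obtain ⟨h0, hd⟩ := hF.hamFlow_spec z
  have hn := wnorm_nonneg (σ ^ 2) z
  set K := σ ^ 4 * wnorm (σ ^ 2) z / 2 + M * σ ^ 2 * wnorm (σ ^ 2) z ^ 2 with hK
  have := norm_le_of_norm_deriv_le_pow (C := σ ^ 4 * wnorm (σ ^ 2) z / 24 + 5 / 9 * K) (h := r) 3
    (f := fun s ↦ (hamFlow U s z).1 - z.1 - s • z.2 - (s ^ 2 / 2) • force U z.1
      - (s / 3) • ∫ t in (0 : ℝ)..s, forceIncr U z t)
    (by simp [h0])
    (fun s ↦ ((((hasFDerivAt_fst.comp_hasDerivAt s (hd s)).sub_const _).sub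
      ((hasDerivAt_id s).smul_const _)).sub (((hasDerivAt_pow 2 s).div_const 2).smul_const _)).sub
      (((hasDerivAt_id s).div_const 3).smul (hF.hasDerivAt_integral_forceIncr z s)))
    (fun s hs hs' ↦ by
      have hs'' : σ * s ≤ 1 / 2 := le_trans (by gcongr) hr'
      have h1 := hF.norm_hamFlow_snd_sub_integral_le hσ z hs hs''
      have h2 := hF.norm_integral_forceIncr_sub_slope_le hσ z hM hs hs''
      have h3 := hF.norm_forceIncr_sub_slope_le hσ z hM hs hs''
      rw [← hK] at h2 h3
      set G := ∫ t in (0 : ℝ)..s, forceIncr U z t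
      simp only [hamField, ContinuousLinearMap.coe_fst', one_smul, id]
      -- The slope terms cancel because `(2 / 3) * (s ^ 2 / 2) = (s / 3) * s`. This is the exactness
      -- of the position weight `r / 3` on linear force increments; only cubic remainders are left.
      have h4 : (hamFlow U s z).2 - z.2 - ((((2 : ℕ) : ℝ) * s ^ (2 - 1)) / 2) • force U z.1
          - ((s / 3) • forceIncr U z s + (1 / 3 : ℝ) • G)
          = ((hamFlow U s z).2 - z.2 - s • force U z.1 - G)
            + (2 / 3 : ℝ) • (G - (s ^ 2 / 2) • forceSlope U z)
            - (s / 3) • (forceIncr U z s - s • forceSlope U z) := by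
        push_cast
        module
      rw [h4]
      calc _ ≤ σ ^ 5 * wnorm (σ ^ 2) z / 12 * s ^ 4 + 2 / 3 * (K / 3 * s ^ 3)
            + s / 3 * (K * s ^ 2) := by
            refine (norm_sub_le _ _).trans (_root_.add_le_add ((norm_add_le _ _).trans
              (_root_.add_le_add h1 ?_)) ?_)
            · rw [norm_smul, Real.norm_of_nonneg (by positivity)]; gcongr
            · rw [norm_smul, Real.norm_of_nonneg (by positivity)]; gcongr
        _ = (σ * s) * (σ ^ 4 * wnorm (σ ^ 2) z / 12 * s ^ 3) + 5 / 9 * K * s ^ 3 := by ring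
        _ ≤ (1 / 2) * (σ ^ 4 * wnorm (σ ^ 2) z / 12 * s ^ 3) + 5 / 9 * K * s ^ 3 := by gcongr
        _ = _ := by ring) hr
  refine this.trans ?_
  have h5 : 0 ≤ σ ^ 4 * wnorm (σ ^ 2) z * r ^ 4 := by positivity
  rw [hK]
  push_cast
  nlinarith

end Local

end RegularForce

end

/-! ### One randomized step: stability, pathwise error, bias and mean-square error -/

section

theorem integral_two_mul_id : ∫ x in (0 : ℝ)..1, 2 * x = 1 := by
  rw [intervalIntegral.integral_const_mul, integral_id]; norm_num

/-- Dropping the null endpoint `0` makes `u` almost surely positive, so the divisions by `u` in the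
scheme are genuine. -/
theorem triangular_eq :
    triangular = (volume.restrict (Ioc (0 : ℝ) 1)).withDensity fun x ↦ ENNReal.ofReal (2 * x) := by
  rw [triangular, restrict_Ioc_eq_restrict_Icc]

theorem ae_triangular_mem : ∀ᵐ u ∂triangular, u ∈ Ioc (0 : ℝ) 1 := by
  rw [triangular_eq]
  exact (withDensity_absolutelyContinuous _ _).ae_le (ae_restrict_mem measurableSet_Ioc)

theorem integral_triangular {V : Type*} [NormedAddCommGroup V] [NormedSpace ℝ V] (f : ℝ → V) :
    ∫ u, f u ∂triangular = ∫ u in (0 : ℝ)..1, (2 * u) • f u := by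
  rw [triangular_eq, integral_withDensity_eq_integral_toReal_smul (by fun_prop)
    (ae_of_all _ fun _ ↦ ENNReal.ofReal_lt_top), intervalIntegral.integral_of_le zero_le_one]
  refine setIntegral_congr_fun measurableSet_Ioc fun u hu ↦ ?_
  rw [ENNReal.toReal_ofReal (by linarith [hu.1])]

instance : IsProbabilityMeasure triangular := by
  constructor
  have h := ofReal_integral_eq_lintegral_ofReal (μ := volume.restrict (Ioc (0 : ℝ) 1))
    (f := fun x ↦ 2 * x) ?_ ?_
  · rw [triangular_eq, withDensity_apply _ MeasurableSet.univ, Measure.restrict_univ, ← h,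
      ← intervalIntegral.integral_of_le zero_le_one, integral_two_mul_id, ENNReal.ofReal_one]
  · exact (Continuous.integrableOn_Icc (by fun_prop)).mono_set Ioc_subset_Icc_self
  · filter_upwards [ae_restrict_mem measurableSet_Ioc] with x hx
    simpa using hx.1.le

variable {E : Type*} [NormedAddCommGroup E] [InnerProductSpace ℝ E]

/-- With a common noise `b` the Gaussian terms cancel, and the velocity difference is multiplied by
`exp (-γ h) ≤ 1`. -/
theorem wnorm_ouStep_sub_le (σ : ℝ) {γ h : ℝ} (hγ : 0 ≤ γ) (hh : 0 ≤ h) (b : E)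
    (z w : E × E) : wnorm (σ ^ 2) (ouStep γ h b z - ouStep γ h b w) ≤ wnorm (σ ^ 2) (z - w) := by
  apply Real.sqrt_le_sqrt
  have h1 : Real.exp (-γ * h) ≤ 1 := Real.exp_le_one_iff.2 (by nlinarith [mul_nonneg hγ hh])
  have h2 : (ouStep γ h b z - ouStep γ h b w).2 = Real.exp (-γ * h) • (z - w).2 := by
    simp [ouStep, smul_sub]
  have h3 : (ouStep γ h b z - ouStep γ h b w).1 = (z - w).1 := rfl
  unfold wnormSq
  rw [h2, h3, norm_smul, Real.norm_of_nonneg (Real.exp_pos _).le]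
  have h4 : Real.exp (-γ * h) * ‖(z - w).2‖ ≤ 1 * ‖(z - w).2‖ := by gcongr
  rw [one_mul] at h4
  gcongr

variable [CompleteSpace E]

namespace RegularForce

variable {U : E → ℝ} {σ M : ℝ}

theorem stronglyMeasurable_rrknStep (hF : RegularForce U σ M)
    (h : ℝ) (z : E × E) :
    StronglyMeasurable fun u ↦ rrknStep U h u z := by
  simp only [rrknStep_eq]
  have hg : StronglyMeasurable fun u ↦ forceIncr U z (u * h) :=
    ((hF.continuous_forceIncr z).comp
      (by fun_prop : Continuous fun u : ℝ ↦ u * h)).stronglyMeasurable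
  have h1 : Measurable fun u : ℝ ↦ h ^ 2 / (6 * u) := by fun_prop
  have h2 : Measurable fun u : ℝ ↦ h / (2 * u) := by fun_prop
  exact (stronglyMeasurable_const.add (h1.stronglyMeasurable.smul hg)).prodMk
    (stronglyMeasurable_const.add (h2.stronglyMeasurable.smul hg))

variable {h : ℝ}

/-- The force increment at time `u h` is `O(u h)`, which compensates the factors `1 / u`. The bound
is pathwise and feeds the moment recursion. -/
theorem wnorm_rrknStep_le (hF : RegularForce U σ M) (hσ : 0 < σ)
    (hh : 0 < h) (hh' : σ * h ≤ 1 / 2)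
    {u : ℝ} (hu : u ∈ Ioc (0 : ℝ) 1) (z : E × E) :
    wnorm (σ ^ 2) (rrknStep U h u z) ≤ Real.exp (3 * (σ * h)) * wnorm (σ ^ 2) z := by
  obtain ⟨hu0, hu1⟩ := hu
  have hn := wnorm_nonneg (σ ^ 2) z
  have hη : 0 < σ * h := by positivity
  have h1 := hF.norm_forceIncr_le hσ z (r := u * h) (by positivity)
    (le_trans (by nlinarith) hh')
  have h2 := norm_snd_le_wnorm hσ z
  have h3 : ‖force U z.1‖ ≤ σ ^ 2 * wnorm (σ ^ 2) z :=
    (hF.norm_le z.1).trans (by gcongr; exact norm_fst_le_wnorm σ z)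
  have h4 : rrknStep U h u z = z + (h • z.2 + (h ^ 2 / 2) • force U z.1
      + (h ^ 2 / (6 * u)) • forceIncr U z (u * h),
      h • force U z.1 + (h / (2 * u)) • forceIncr U z (u * h)) := by
    rw [rrknStep_eq]; ext <;> simp [add_assoc]
  set n := wnorm (σ ^ 2) z
  have h5 : ‖h • z.2 + (h ^ 2 / 2) • force U z.1 + (h ^ 2 / (6 * u)) • forceIncr U z (u * h)‖
      ≤ h * (σ * n) + h ^ 2 / 2 * (σ ^ 2 * n)
        + h ^ 2 / (6 * u) * (5 / 4 * (σ ^ 3 * n * (u * h))) := by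
    refine (norm_add₃_le).trans ?_
    simp only [norm_smul]
    rw [Real.norm_of_nonneg hh.le, Real.norm_of_nonneg (by positivity),
      Real.norm_of_nonneg (by positivity)]
    gcongr
  have h6 : ‖h • force U z.1 + (h / (2 * u)) • forceIncr U z (u * h)‖
      ≤ h * (σ ^ 2 * n) + h / (2 * u) * (5 / 4 * (σ ^ 3 * n * (u * h))) := by
    refine (norm_add_le _ _).trans ?_
    simp only [norm_smul]
    rw [Real.norm_of_nonneg hh.le, Real.norm_of_nonneg (by positivity)]
    gcongr
  rw [h4]
  calc _ ≤ n + _ := wnorm_add_le _ _ _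
    _ ≤ n + ((h * (σ * n) + h ^ 2 / 2 * (σ ^ 2 * n)
        + h ^ 2 / (6 * u) * (5 / 4 * (σ ^ 3 * n * (u * h))))
        + σ⁻¹ * (h * (σ ^ 2 * n) + h / (2 * u) * (5 / 4 * (σ ^ 3 * n * (u * h))))) := by
        gcongr
        refine (wnorm_le_add hσ _).trans ?_
        gcongr
    _ = n + (σ * h) * n * (2 + 9 / 8 * (σ * h) + 5 / 24 * (σ * h) ^ 2) := by
        field_simp; ring
    _ ≤ n + (σ * h) * n * (2 + 9 / 8 * (1 / 2) + 5 / 24 * (1 / 2) ^ 2) := by gcongr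
    _ ≤ (3 * (σ * h) + 1) * n := by
        have : 0 ≤ σ * h * n := by positivity
        nlinarith
    _ ≤ _ := by gcongr; exact Real.add_one_le_exp _

/-- Subtracting the linear part of the force increment from scheme and flow alike leaves third-order
terms: `h / (2 u)` and `h ^ 2 / (6 u)` turn the slope at `u h` into contributions free of `u`, equal
to those of the flow. -/
theorem wnorm_rrknStep_sub_hamFlow_le (hF : RegularForce U σ M) (hσ : 0 < σ)
    (hh : 0 < h) (hh' : σ * h ≤ 1 / 2)
    (hM : 0 ≤ M) {u : ℝ} (hu : u ∈ Ioc (0 : ℝ) 1) (z : E × E) :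
    wnorm (σ ^ 2) (rrknStep U h u z - hamFlow U h z) ≤
      (σ * h) ^ 3 * wnorm (σ ^ 2) z + 2 * (M * σ * h ^ 3 * wnorm (σ ^ 2) z ^ 2) := by
  obtain ⟨hu0, hu1⟩ := hu
  have hn := wnorm_nonneg (σ ^ 2) z
  have hη : 0 < σ * h := by positivity
  have h1 := hF.norm_hamFlow_fst_sub_integral_le hσ z hM hh.le hh'
  have h2 := hF.norm_hamFlow_snd_sub_integral_le hσ z hh.le hh'
  have h3 := hF.norm_integral_forceIncr_sub_slope_le hσ z hM hh.le hh'
  have h4 := hF.norm_forceIncr_sub_slope_le hσ z hM (r := u * h) (by positivity)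
    (le_trans (by nlinarith) hh')
  set n := wnorm (σ ^ 2) z
  set G := ∫ s in (0 : ℝ)..h, forceIncr U z s
  set K := σ ^ 4 * n / 2 + M * σ ^ 2 * n ^ 2 with hK
  have hK0 : 0 ≤ K := by positivity
  have h5 : (rrknStep U h u z - hamFlow U h z).1 =
      (h ^ 2 / (6 * u)) • (forceIncr U z (u * h) - (u * h) • forceSlope U z)
      - (h / 3) • (G - (h ^ 2 / 2) • forceSlope U z)
      - ((hamFlow U h z).1 - z.1 - h • z.2 - (h ^ 2 / 2) • force U z.1 - (h / 3) • G) := by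
    have : h ^ 2 / (6 * u) * (u * h) = h / 3 * (h ^ 2 / 2) := by field_simp; ring
    rw [rrknStep_eq, Prod.fst_sub, smul_sub, smul_sub, smul_smul, smul_smul, this]
    dsimp only
    abel
  have h6 : (rrknStep U h u z - hamFlow U h z).2 =
      (h / (2 * u)) • (forceIncr U z (u * h) - (u * h) • forceSlope U z)
      - (G - (h ^ 2 / 2) • forceSlope U z)
      - ((hamFlow U h z).2 - z.2 - h • force U z.1 - G) := by
    have : h / (2 * u) * (u * h) = h ^ 2 / 2 := by field_simp
    rw [rrknStep_eq, Prod.snd_sub, smul_sub, smul_smul, this]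
    dsimp only
    abel
  have h7 : ‖(rrknStep U h u z - hamFlow U h z).1‖ ≤
      h ^ 2 / (6 * u) * (K * (u * h) ^ 2) + h / 3 * (K / 3 * h ^ 3)
      + (σ ^ 4 * n / 12 + M * σ ^ 2 * n ^ 2 * (5 / 36)) * h ^ 4 := by
    rw [h5]
    refine (norm_sub_le _ _).trans (_root_.add_le_add ((norm_sub_le _ _).trans ?_) h1)
    rw [norm_smul, norm_smul, Real.norm_of_nonneg (by positivity),
      Real.norm_of_nonneg (by positivity)]
    gcongr
  have h8 : ‖(rrknStep U h u z - hamFlow U h z).2‖ ≤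
      h / (2 * u) * (K * (u * h) ^ 2) + K / 3 * h ^ 3 + σ ^ 5 * n / 12 * h ^ 4 := by
    rw [h6]
    refine (norm_sub_le _ _).trans (_root_.add_le_add ((norm_sub_le _ _).trans ?_) h2)
    rw [norm_smul, Real.norm_of_nonneg (by positivity)]
    gcongr
  have hp : 0 ≤ (σ * h) ^ 3 * n := by positivity
  have hq : 0 ≤ M * σ * h ^ 3 * n ^ 2 := by positivity
  calc _ ≤ _ := wnorm_le_add hσ _
    _ ≤ (h ^ 2 / (6 * u) * (K * (u * h) ^ 2) + h / 3 * (K / 3 * h ^ 3)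
      + (σ ^ 4 * n / 12 + M * σ ^ 2 * n ^ 2 * (5 / 36)) * h ^ 4)
      + σ⁻¹ * (h / (2 * u) * (K * (u * h) ^ 2) + K / 3 * h ^ 3 + σ ^ 5 * n / 12 * h ^ 4) := by
        gcongr
    _ = (u * (1 / 6) + 1 / 9) * ((σ * h) * ((σ * h) ^ 3 * n / 2 + M * σ * h ^ 3 * n ^ 2))
      + (σ * h) * ((σ * h) ^ 3 * n / 12 + M * σ * h ^ 3 * n ^ 2 * (5 / 36))
      + (u / 2 + 1 / 3) * ((σ * h) ^ 3 * n / 2 + M * σ * h ^ 3 * n ^ 2)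
      + (σ * h) * ((σ * h) ^ 3 * n / 12) := by
        rw [hK]; field_simp; ring
    _ ≤ (1 * (1 / 6) + 1 / 9) * ((1 / 2) * ((σ * h) ^ 3 * n / 2 + M * σ * h ^ 3 * n ^ 2))
      + (1 / 2) * ((σ * h) ^ 3 * n / 12 + M * σ * h ^ 3 * n ^ 2 * (5 / 36))
      + (1 / 2 + 1 / 3) * ((σ * h) ^ 3 * n / 2 + M * σ * h ^ 3 * n ^ 2)
      + (1 / 2) * ((σ * h) ^ 3 * n / 12) := by gcongr
    _ ≤ _ := by linarith

theorem integrable_rrknStep_sub_hamFlow (hF : RegularForce U σ M) (hσ : 0 < σ)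
    (hh : 0 < h) (hh' : σ * h ≤ 1 / 2)
    (hM : 0 ≤ M) (z : E × E) :
    Integrable (fun u ↦ rrknStep U h u z - hamFlow U h z) triangular := by
  refine Integrable.of_bound
    ((hF.stronglyMeasurable_rrknStep h z).sub stronglyMeasurable_const).aestronglyMeasurable
    ((1 + σ) * ((σ * h) ^ 3 * wnorm (σ ^ 2) z + 2 * (M * σ * h ^ 3 * wnorm (σ ^ 2) z ^ 2))) ?_
  filter_upwards [ae_triangular_mem] with u hu
  refine le_trans ?_ (mul_le_mul_of_nonneg_left
    (hF.wnorm_rrknStep_sub_hamFlow_le hσ hh hh' hM hu z) (by positivity))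
  have h1 := norm_fst_le_wnorm σ (rrknStep U h u z - hamFlow U h z)
  have h2 := norm_snd_le_wnorm hσ (rrknStep U h u z - hamFlow U h z)
  have h3 := wnorm_nonneg (σ ^ 2) (rrknStep U h u z - hamFlow U h z)
  rw [Prod.norm_def, sup_le_iff]
  constructor <;> nlinarith

/-- Averaging against the density `2 u` removes `1 / u`, so the mean of the scheme is built from the
integral of the force increment over the step. The gain over the pathwise bound is a factor `σ h`.
-/
theorem wnorm_integral_rrknStep_sub_hamFlow_le (hF : RegularForce U σ M) (hσ : 0 < σ)
    (hh : 0 < h) (hh' : σ * h ≤ 1 / 2)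
    (hM : 0 ≤ M) (z : E × E) :
    wnorm (σ ^ 2) (∫ u, (rrknStep U h u z - hamFlow U h z) ∂triangular) ≤
      σ * h / 4 * ((σ * h) ^ 3 * wnorm (σ ^ 2) z + M * σ * h ^ 3 * wnorm (σ ^ 2) z ^ 2) := by
  have hn := wnorm_nonneg (σ ^ 2) z
  have hη : 0 < σ * h := by positivity
  have h1 := hF.norm_hamFlow_fst_sub_integral_le hσ z hM hh.le hh'
  have h2 := hF.norm_hamFlow_snd_sub_integral_le hσ z hh.le hh'
  have hint := hF.integrable_rrknStep_sub_hamFlow hσ hh hh' hM z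
  have hG : (∫ s in (0 : ℝ)..h, forceIncr U z s) =
      h • ∫ u in (0 : ℝ)..1, forceIncr U z (u * h) := by
    rw [intervalIntegral.smul_integral_comp_mul_right]; simp
  -- Constant terms keep the weight `2 u`, of total mass one; in the force terms that weight has
  -- already been spent on cancelling `1 / u`.
  have hlin : ∀ (a : E) (c : ℝ), (∫ u in (0 : ℝ)..1, ((2 * u) • a + c • forceIncr U z (u * h)))
      = a + c • ∫ u in (0 : ℝ)..1, forceIncr U z (u * h) := by
    intro a c
    have hg : Continuous fun u ↦ forceIncr U z (u * h) :=
      (hF.continuous_forceIncr z).comp (by fun_prop)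
    rw [intervalIntegral.integral_add (Continuous.intervalIntegrable (by fun_prop) _ _)
      (Continuous.intervalIntegrable (by fun_prop) _ _), intervalIntegral.integral_smul,
      intervalIntegral.integral_smul_const, integral_two_mul_id, one_smul]
  have h3 : (∫ u, (rrknStep U h u z - hamFlow U h z) ∂triangular).1 =
      -((hamFlow U h z).1 - z.1 - h • z.2 - (h ^ 2 / 2) • force U z.1
        - (h / 3) • ∫ s in (0 : ℝ)..h, forceIncr U z s) := by
    have h4 := (ContinuousLinearMap.fst ℝ E E).integral_comp_comm hint
    simp only [ContinuousLinearMap.coe_fst'] at h4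
    rw [← h4, integral_triangular]
    have h5 := hlin (z.1 + h • z.2 + (h ^ 2 / 2) • force U z.1 - (hamFlow U h z).1) (h ^ 2 / 3)
    rw [hG, smul_smul]
    trans
    · refine (intervalIntegral.integral_congr_ae (ae_of_all _ fun u hu ↦ ?_)).trans h5
      rw [uIoc_of_le zero_le_one] at hu
      have : 2 * u * (h ^ 2 / (6 * u)) = h ^ 2 / 3 := by have := hu.1; field_simp; norm_num
      have : (h ^ 2 / 3) • forceIncr U z (u * h)
        = (2 * u * (h ^ 2 / (6 * u))) • forceIncr U z (u * h) := by rw [this]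
      rw [rrknStep_eq, Prod.fst_sub, this]
      dsimp only
      module
    · have : h / 3 * h = h ^ 2 / 3 := by ring
      rw [this]; abel
  have h4 : (∫ u, (rrknStep U h u z - hamFlow U h z) ∂triangular).2 =
      -((hamFlow U h z).2 - z.2 - h • force U z.1 - ∫ s in (0 : ℝ)..h, forceIncr U z s) := by
    have h4 := (ContinuousLinearMap.snd ℝ E E).integral_comp_comm hint
    simp only [ContinuousLinearMap.coe_snd'] at h4
    rw [← h4, integral_triangular]
    have h5 := hlin (z.2 + h • force U z.1 - (hamFlow U h z).2) h
    rw [hG]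
    trans
    · refine (intervalIntegral.integral_congr_ae (ae_of_all _ fun u hu ↦ ?_)).trans h5
      rw [uIoc_of_le zero_le_one] at hu
      have : 2 * u * (h / (2 * u)) = h := by have := hu.1; field_simp
      have : h • forceIncr U z (u * h)
        = (2 * u * (h / (2 * u))) • forceIncr U z (u * h) := by rw [this]
      rw [rrknStep_eq, Prod.snd_sub, this]
      dsimp only
      module
    · abel
  refine (wnorm_le_add hσ _).trans ?_
  rw [h3, h4, norm_neg, norm_neg]
  have hp : 0 ≤ (σ * h) * ((σ * h) ^ 3 * wnorm (σ ^ 2) z) := by positivity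
  have hq : 0 ≤ (σ * h) * (M * σ * h ^ 3 * wnorm (σ ^ 2) z ^ 2) := by positivity
  calc _ ≤ (σ ^ 4 * wnorm (σ ^ 2) z / 12 + M * σ ^ 2 * wnorm (σ ^ 2) z ^ 2 * (5 / 36)) * h ^ 4
        + σ⁻¹ * (σ ^ 5 * wnorm (σ ^ 2) z / 12 * h ^ 4) := by gcongr
    _ = (σ * h) * ((σ * h) ^ 3 * wnorm (σ ^ 2) z) / 6
        + (σ * h) * (M * σ * h ^ 3 * wnorm (σ ^ 2) z ^ 2) * (5 / 36) := by field_simp; ring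
    _ ≤ _ := by linarith

/-- The one-step mean-square error estimate: started from different points, one step of the
randomized scheme and the exact flow drift apart by a factor `exp (3 σ h / 2)` and an additional
local error of order `h ^ 3`. -/
theorem integral_wnorm_rrknStep_sub_hamFlow_sq_le (hF : RegularForce U σ M) (hσ : 0 < σ)
    (hh : 0 < h) (hh' : σ * h ≤ 1 / 2)
    (hM : 0 ≤ M) (z w : E × E) :
    Integrable (fun u ↦ wnorm (σ ^ 2) (rrknStep U h u z - hamFlow U h w) ^ 2) triangular ∧
    ∫ u, wnorm (σ ^ 2) (rrknStep U h u z - hamFlow U h w) ^ 2 ∂triangular ≤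
      Real.exp (3 * (σ * h)) * wnorm (σ ^ 2) (z - w) ^ 2
        + (3 * (σ * h) ^ 6 * wnorm (σ ^ 2) z ^ 2
          + 9 * (M * σ * h ^ 3) ^ 2 * wnorm (σ ^ 2) z ^ 4) := by
  set a := weightedEmb E σ (hamFlow U h z - hamFlow U h w) with ha
  set ρ : ℝ → WithLp 2 (E × E) := fun u ↦ weightedEmb E σ (rrknStep U h u z - hamFlow U h z) with hρ
  set n := wnorm (σ ^ 2) z with hn_def
  have hn : 0 ≤ n := wnorm_nonneg (σ ^ 2) z
  have hη : 0 < σ * h := by positivity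
  have hint := hF.integrable_rrknStep_sub_hamFlow hσ hh hh' hM z
  have hρint : Integrable ρ triangular := (weightedEmb E σ).integrable_comp hint
  have hρmean : ‖∫ u, ρ u ∂triangular‖ ≤ σ * h / 4 * ((σ * h) ^ 3 * n + M * σ * h ^ 3 * n ^ 2) := by
    rw [hρ, (weightedEmb E σ).integral_comp_comm hint, norm_weightedEmb]
    exact hF.wnorm_integral_rrknStep_sub_hamFlow_le hσ hh hh' hM z
  have hρb : ∀ᵐ u ∂triangular, ‖ρ u‖ ^ 2 ≤
      ((σ * h) ^ 3 * n + 2 * (M * σ * h ^ 3 * n ^ 2)) ^ 2 := by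
    filter_upwards [ae_triangular_mem] with u hu
    rw [hρ]
    simp only [norm_weightedEmb]
    exact pow_le_pow_left₀ (wnorm_nonneg _ _)
      (hF.wnorm_rrknStep_sub_hamFlow_le hσ hh hh' hM hu z) 2
  have hρsq : Integrable (fun u ↦ ‖ρ u‖ ^ 2) triangular := by
    refine Integrable.of_bound (hρint.aestronglyMeasurable.norm.pow 2)
      (((σ * h) ^ 3 * n + 2 * (M * σ * h ^ 3 * n ^ 2)) ^ 2) ?_
    filter_upwards [hρb] with u hu
    rwa [Real.norm_of_nonneg (sq_nonneg _)]
  -- The error splits into `a`, the propagated initial difference, independent of `u`, and the local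
  -- error `ρ u`. The cross term therefore sees only the mean of `ρ`.
  have hexp : (fun u ↦ wnorm (σ ^ 2) (rrknStep U h u z - hamFlow U h w) ^ 2) =
      fun u ↦ ‖a‖ ^ 2 + 2 * inner ℝ a (ρ u) + ‖ρ u‖ ^ 2 := by
    ext u
    rw [← norm_weightedEmb, ← norm_add_sq_real, ha, hρ]
    simp only [← map_add]
    congr 3; abel
  have hi1 : Integrable (fun u ↦ 2 * inner ℝ a (ρ u)) triangular :=
    (hρint.const_inner a).const_mul 2
  have hi2 : Integrable (fun u ↦ ‖a‖ ^ 2 + 2 * inner ℝ a (ρ u)) triangular :=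
    (integrable_const _).add hi1
  rw [hexp]
  refine ⟨hi2.add hρsq, ?_⟩
  rw [integral_add hi2 hρsq, integral_add (integrable_const _) hi1, integral_const_mul,
    integral_inner hρint]
  simp only [integral_const, probReal_univ, one_smul]
  have h1 : ‖a‖ ≤ Real.exp (σ * h) * wnorm (σ ^ 2) (z - w) := by
    rw [ha, norm_weightedEmb]; exact hF.wnorm_hamFlow_sub_le hσ hh.le z w
  have h2 : ∫ u, ‖ρ u‖ ^ 2 ∂triangular ≤ ((σ * h) ^ 3 * n + 2 * (M * σ * h ^ 3 * n ^ 2)) ^ 2 := by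
    simpa using integral_mono_ae hρsq (integrable_const _) hρb
  have h3 := real_inner_le_norm a (∫ u, ρ u ∂triangular)
  have h4 : (1 + σ * h) * ‖a‖ ^ 2 ≤ Real.exp (3 * (σ * h)) * wnorm (σ ^ 2) (z - w) ^ 2 := by
    calc _ ≤ Real.exp (σ * h) * (Real.exp (σ * h) * wnorm (σ ^ 2) (z - w)) ^ 2 := by
          gcongr
          linarith [Real.add_one_le_exp (σ * h)]
      _ = _ := by rw [mul_pow, ← Real.exp_nat_mul, ← mul_assoc, ← Real.exp_add]; congr 2; ring
  have h5 : ‖a‖ * ‖∫ u, ρ u ∂triangular‖ ≤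
      ‖a‖ * (σ * h / 4 * ((σ * h) ^ 3 * n + M * σ * h ^ 3 * n ^ 2)) := by gcongr
  set p := (σ * h) ^ 3 * n
  set q := M * σ * h ^ 3 * n ^ 2
  -- Young's inequality with weight `σ h`: since the bias is itself `O(σ h)`, the cross term costs
  -- only a factor `1 + σ h` on `‖a‖ ^ 2`. Together with `exp (2 σ h)` from the flow this gives `exp
  -- (3 σ h)`.
  have h6 : 2 * (‖a‖ * (σ * h / 4 * (p + q))) ≤ σ * h * ‖a‖ ^ 2 + σ * h * ((p + q) ^ 2 / 16) := by
    nlinarith [mul_nonneg hη.le (sq_nonneg (‖a‖ - (p + q) / 4))]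
  have h7 : σ * h * ((p + q) ^ 2 / 16) ≤ 1 / 2 * ((p + q) ^ 2 / 16) := by gcongr
  have h8 : 3 * (σ * h) ^ 6 * n ^ 2 + 9 * (M * σ * h ^ 3) ^ 2 * n ^ 4 = 3 * p ^ 2 + 9 * q ^ 2 := by
    ring
  rw [h8]
  nlinarith [sq_nonneg (p - q), sq_nonneg (p - 2 * q), sq_nonneg p, sq_nonneg q]

end RegularForce

end

/-! ### Independence, Gaussian moments and the Ornstein-Uhlenbeck step -/

section

section Independence

variable {Ω α β δ : Type*} [MeasurableSpace Ω] [MeasurableSpace α] [MeasurableSpace β]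
  [MeasurableSpace δ] {P : Measure Ω} [IsProbabilityMeasure P]

/-- If `A`, `B` are independent and `(A, B)` is independent of `C`, then `(A, C)` is independent
of `B`. -/
theorem indepFun_prodMk_of_indepFun {A : Ω → α} {B : Ω → β} {C : Ω → δ} (hA : Measurable A)
    (hB : Measurable B) (hC : Measurable C) (hAB : IndepFun A B P)
    (hABC : IndepFun (fun ω ↦ (A ω, B ω)) C P) : IndepFun (fun ω ↦ (A ω, C ω)) B P := by
  have hAC : IndepFun A C P := hABC.comp measurable_fst measurable_id
  have := Measure.isProbabilityMeasure_map (μ := P) hA.aemeasurable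
  have := Measure.isProbabilityMeasure_map (μ := P) hB.aemeasurable
  have := Measure.isProbabilityMeasure_map (μ := P) hC.aemeasurable
  have h1 := (indepFun_iff_map_prod_eq_prod_map_map hA.aemeasurable hB.aemeasurable).1 hAB
  have h2 := (indepFun_iff_map_prod_eq_prod_map_map (hA.prodMk hB).aemeasurable
    hC.aemeasurable).1 hABC
  have h3 := (indepFun_iff_map_prod_eq_prod_map_map hA.aemeasurable hC.aemeasurable).1 hAC
  rw [indepFun_iff_map_prod_eq_prod_map_map (hA.prodMk hC).aemeasurable hB.aemeasurable, h3]
  rw [h1] at h2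
  have h4 : P.map (fun ω ↦ (A ω, (B ω, C ω))) =
      (P.map A).prod ((P.map B).prod (P.map C)) := by
    rw [← Measure.prodAssoc_prod, ← h2, Measure.map_map (by fun_prop) (by fun_prop)]
    rfl
  have h5 : P.map (fun ω ↦ (A ω, (C ω, B ω))) =
      (P.map A).prod ((P.map C).prod (P.map B)) := by
    rw [← Measure.prod_swap (μ := P.map B), ← Measure.map_id (μ := P.map A),
      Measure.map_prod_map _ _ measurable_id measurable_swap, ← h4,
      Measure.map_map (by fun_prop) (by fun_prop)]
    rfl
  have h6 : (((P.map A).prod (P.map C)).prod (P.map B)) =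
      Measure.map MeasurableEquiv.prodAssoc.symm ((P.map A).prod ((P.map C).prod (P.map B))) := by
    rw [← Measure.prodAssoc_prod, Measure.map_map (by fun_prop) (by fun_prop)]
    simp
  rw [h6, ← h5, Measure.map_map (by fun_prop) (by fun_prop)]
  rfl

/-- Integrating out an independent variable. -/
theorem integral_comp_le_of_indepFun {X : Ω → α} {Y : Ω → β} (hX : Measurable X)
    (hY : Measurable Y) (hXY : IndepFun X Y P) {f : α × β → ℝ} (hf : Measurable f)
    (hf0 : ∀ p, 0 ≤ f p) {g : α → ℝ} (hg : Measurable g) (hgi : Integrable (fun ω ↦ g (X ω)) P)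
    (hfi : ∀ x, Integrable (fun y ↦ f (x, y)) (P.map Y))
    (hfg : ∀ x, ∫ y, f (x, y) ∂(P.map Y) ≤ g x) :
    Integrable (fun ω ↦ f (X ω, Y ω)) P ∧ ∫ ω, f (X ω, Y ω) ∂P ≤ ∫ ω, g (X ω) ∂P := by
  have := Measure.isProbabilityMeasure_map (μ := P) hX.aemeasurable
  have := Measure.isProbabilityMeasure_map (μ := P) hY.aemeasurable
  have hmap := (indepFun_iff_map_prod_eq_prod_map_map hX.aemeasurable hY.aemeasurable).1 hXY
  have hgi' : Integrable g (P.map X) :=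
    (integrable_map_measure hg.aestronglyMeasurable hX.aemeasurable).2 hgi
  have hint : Integrable f ((P.map X).prod (P.map Y)) := by
    refine (integrable_prod_iff hf.aestronglyMeasurable).2 ⟨ae_of_all _ hfi, ?_⟩
    refine hgi'.mono' (hf.stronglyMeasurable.norm.integral_prod_right').aestronglyMeasurable
      (ae_of_all _ fun x ↦ ?_)
    simp only [Real.norm_of_nonneg (hf0 _)]
    rw [Real.norm_of_nonneg (integral_nonneg fun y ↦ hf0 _)]
    exact hfg x
  constructor
  · have h := hint
    rw [← hmap] at h
    exact (integrable_map_measure hf.aestronglyMeasurable (hX.prodMk hY).aemeasurable).1 h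
  · calc ∫ ω, f (X ω, Y ω) ∂P = ∫ p, f p ∂((P.map X).prod (P.map Y)) := by
          rw [← hmap, integral_map (hX.prodMk hY).aemeasurable hf.aestronglyMeasurable]
      _ = ∫ x, ∫ y, f (x, y) ∂(P.map Y) ∂(P.map X) := integral_prod f hint
      _ ≤ ∫ x, g x ∂(P.map X) := integral_mono hint.integral_prod_left hgi' hfg
      _ = _ := integral_map hX.aemeasurable hg.aestronglyMeasurable

/-- The past of an independent sequence, together with an independent source of randomness, is
independent of the present. -/
theorem indepFun_past_present {ξ : ℕ → Ω → α} {C : Ω → δ} (hξ : ∀ i, Measurable (ξ i))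
    (hC : Measurable C) (hind : iIndepFun ξ P) (hξC : IndepFun (fun ω i ↦ ξ i ω) C P) (k : ℕ) :
    IndepFun (fun ω ↦ ((fun i : Finset.range k ↦ ξ i ω), C ω)) (ξ k) P := by
  have h1 := hind.indepFun_finset (Finset.range k) {k} (by simp) hξ
  have h2 : IndepFun (fun ω (i : Finset.range k) ↦ ξ i ω) (ξ k) P :=
    h1.comp measurable_id (measurable_pi_apply (⟨k, by simp⟩ : ({k} : Finset ℕ)))
  refine indepFun_prodMk_of_indepFun (by fun_prop) (hξ k) hC h2 ?_
  exact hξC.comp (φ := fun x : ℕ → α ↦ ((fun i : Finset.range k ↦ x i), x k))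
    (by fun_prop) measurable_id

end Independence

/-- Common shape of the majorants to be integrated: linear, quadratic and quartic terms in a
Gaussian, or squared error with second and fourth moments. Unneeded slots receive coefficient `0`.
-/
theorem integral_affine_three {α : Type*} [MeasurableSpace α] {μ : Measure α}
    [IsProbabilityMeasure μ] {f g k : α → ℝ} (hf : Integrable f μ) (hg : Integrable g μ)
    (hk : Integrable k μ) (a b c e : ℝ) :
    Integrable (fun x ↦ a + b * f x + c * g x + e * k x) μ ∧
    ∫ x, (a + b * f x + c * g x + e * k x) ∂μ =
      a + b * ∫ x, f x ∂μ + c * ∫ x, g x ∂μ + e * ∫ x, k x ∂μ := by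
  have h1 : Integrable (fun x ↦ a + b * f x) μ := (integrable_const a).add (hf.const_mul b)
  have h2 : Integrable (fun x ↦ a + b * f x + c * g x) μ := h1.add (hg.const_mul c)
  refine ⟨h2.add (hk.const_mul e), ?_⟩
  rw [integral_add h2 (hk.const_mul e), integral_add h1 (hg.const_mul c),
    integral_add (integrable_const a) (hf.const_mul b), integral_const_mul, integral_const_mul,
    integral_const_mul]
  simp

section Gaussian

/-- The noise constant of the moment estimates: a combination of the second and fourth moments of
the standard Gaussian distribution on the line. -/
def gaussConst : ℝ := 1 + 5 * ∫ x, x ^ 2 ∂gaussianReal 0 1 + 2 * ∫ x, x ^ 4 ∂gaussianReal 0 1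

variable {d : ℕ}

theorem integrable_norm_pow_stdGaussian (p : ℕ) :
    Integrable (fun b ↦ ‖b‖ ^ p) (stdGaussian (EuclideanSpace ℝ (Fin d))) := by
  rcases p.eq_zero_or_pos with rfl | hp
  · simp
  · exact (IsGaussian.memLp_id (stdGaussian (EuclideanSpace ℝ (Fin d))) p
      (by simp)).integrable_norm_pow hp.ne'

theorem integrable_pow_gaussianReal (p : ℕ) :
    Integrable (fun x ↦ x ^ p) (gaussianReal 0 1) := by
  have : Integrable (fun x ↦ ‖x‖ ^ p) (gaussianReal 0 1) := by
    rcases p.eq_zero_or_pos with rfl | hp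
    · simp
    · exact (memLp_id_gaussianReal (p : ℝ≥0)).integrable_norm_pow hp.ne'
  refine this.mono' (by fun_prop) (ae_of_all _ fun x ↦ ?_)
  rw [norm_pow]

theorem integral_sum_pow_pi_gaussianReal (p : ℕ) :
    Integrable (fun x : Fin d → ℝ ↦ ∑ i, x i ^ p) (Measure.pi fun _ ↦ gaussianReal 0 1) ∧
    ∫ x : Fin d → ℝ, ∑ i, x i ^ p ∂(Measure.pi fun _ ↦ gaussianReal 0 1) =
      d * ∫ x, x ^ p ∂gaussianReal 0 1 := by
  have hi : ∀ i : Fin d, Integrable (fun x : Fin d → ℝ ↦ x i ^ p)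
      (Measure.pi fun _ ↦ gaussianReal 0 1) := fun i ↦
    integrable_comp_eval (μ := fun _ : Fin d ↦ gaussianReal 0 1) (i := i) (f := fun x : ℝ ↦ x ^ p)
      (integrable_pow_gaussianReal p)
  refine ⟨integrable_finsetSum _ fun i _ ↦ hi i, ?_⟩
  rw [integral_finsetSum _ fun i _ ↦ hi i]
  have : ∀ i : Fin d, ∫ x : Fin d → ℝ, x i ^ p ∂(Measure.pi fun _ ↦ gaussianReal 0 1) =
      ∫ x, x ^ p ∂gaussianReal 0 1 := fun i ↦
    integral_comp_eval (μ := fun _ : Fin d ↦ gaussianReal 0 1) (i := i) (f := fun x : ℝ ↦ x ^ p)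
      (by fun_prop)
  simp [this]

theorem integral_norm_sq_stdGaussian :
    ∫ b, ‖b‖ ^ 2 ∂stdGaussian (EuclideanSpace ℝ (Fin d)) =
      d * ∫ x, x ^ 2 ∂gaussianReal 0 1 := by
  rw [← map_pi_eq_stdGaussian, integral_map (by fun_prop) (by fun_prop)]
  simp_rw [EuclideanSpace.real_norm_sq_eq]
  exact (integral_sum_pow_pi_gaussianReal 2).2

/-- Cauchy-Schwarz over the `d` coordinates reduces to one-dimensional fourth moments. The factor `d
^ 2` lets the fourth moment be bounded by the square of a second-moment bound with the same
dimension dependence. -/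
theorem integral_norm_pow_four_stdGaussian_le :
    ∫ b, ‖b‖ ^ 4 ∂stdGaussian (EuclideanSpace ℝ (Fin d)) ≤
      d ^ 2 * ∫ x, x ^ 4 ∂gaussianReal 0 1 := by
  obtain ⟨h1, h2⟩ := integral_sum_pow_pi_gaussianReal (d := d) 4
  have h3 : ∀ b : EuclideanSpace ℝ (Fin d), ‖b‖ ^ 4 ≤ d * ∑ i, b i ^ 4 := fun b ↦ by
    have h := sq_sum_le_card_mul_sum_sq (s := Finset.univ) (f := fun i ↦ b i ^ 2)
    simp only [← pow_mul, Finset.card_univ, Fintype.card_fin] at h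
    calc ‖b‖ ^ 4 = (‖b‖ ^ 2) ^ 2 := by ring
      _ ≤ _ := by rw [EuclideanSpace.real_norm_sq_eq]; exact h
  rw [← map_pi_eq_stdGaussian, integral_map (by fun_prop) (by fun_prop)]
  calc _ ≤ ∫ x : Fin d → ℝ, d * ∑ i, x i ^ 4 ∂(Measure.pi fun _ ↦ gaussianReal 0 1) := by
        refine integral_mono_of_nonneg (ae_of_all _ fun _ ↦ by positivity) (h1.const_mul _)
          (ae_of_all _ fun x ↦ ?_)
        exact h3 (WithLp.toLp 2 x)
    _ = _ := by rw [integral_const_mul, h2]; ring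

theorem gaussConst_pos : 0 < gaussConst := by
  have h2 : 0 ≤ ∫ x, x ^ 2 ∂gaussianReal 0 1 := integral_nonneg fun _ ↦ sq_nonneg _
  have h4 : 0 ≤ ∫ x, x ^ 4 ∂gaussianReal 0 1 := integral_nonneg fun _ ↦ by positivity
  unfold gaussConst; linarith

/-- The summand `1` in `gaussConst` serves here: `(1 + x) ^ 2 ≥ x` for nonnegative `x`. No explicit
Gaussian moment is ever computed. -/
theorem two_mul_fourth_moment_le :
    2 * ∫ x, x ^ 4 ∂gaussianReal 0 1 ≤ gaussConst ^ 2 := by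
  have h2 : 0 ≤ ∫ x, x ^ 2 ∂gaussianReal 0 1 := integral_nonneg fun _ ↦ sq_nonneg _
  have h4 : 0 ≤ ∫ x, x ^ 4 ∂gaussianReal 0 1 := integral_nonneg fun _ ↦ by positivity
  have h1 : 1 + 2 * ∫ x, x ^ 4 ∂gaussianReal 0 1 ≤ gaussConst := by unfold gaussConst; linarith
  nlinarith

/-- The variance injected by one Ornstein-Uhlenbeck step, in the squared weighted norm. -/
def noiseLevel (σ γ h : ℝ) (d : ℕ) : ℝ := (σ ^ 2)⁻¹ * (1 - Real.exp (-2 * γ * h)) * d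

theorem noiseLevel_nonneg (σ : ℝ) {γ h : ℝ} (hγ : 0 ≤ γ) (hh : 0 ≤ h) (d : ℕ) :
    0 ≤ noiseLevel σ γ h d := by
  have h1 : Real.exp (-2 * γ * h) ≤ 1 := Real.exp_le_one_iff.2 (by nlinarith [mul_nonneg hγ hh])
  have : 0 ≤ 1 - Real.exp (-2 * γ * h) := by linarith
  unfold noiseLevel; positivity

theorem noiseLevel_le (σ γ h : ℝ) (d : ℕ) :
    noiseLevel σ γ h d ≤ (σ ^ 2)⁻¹ * (2 * γ * h) * d := by
  unfold noiseLevel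
  gcongr
  linarith [Real.add_one_le_exp (-2 * γ * h)]

theorem wnormSq_ouStep {E : Type*} [NormedAddCommGroup E] [InnerProductSpace ℝ E]
    (σ γ h : ℝ) (b : E) (y : E × E) :
    wnormSq (σ ^ 2) (ouStep γ h b y) =
      (‖y.1‖ ^ 2 + (σ ^ 2)⁻¹ * (Real.exp (-γ * h) * ‖y.2‖) ^ 2)
      + 2 * ((σ ^ 2)⁻¹ * Real.exp (-γ * h) * √(1 - Real.exp (-2 * γ * h)) * inner ℝ y.2 b)
      + (σ ^ 2)⁻¹ * √(1 - Real.exp (-2 * γ * h)) ^ 2 * ‖b‖ ^ 2 := by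
  unfold wnormSq ouStep
  simp only
  rw [norm_add_sq_real, norm_smul, norm_smul, real_inner_smul_left, real_inner_smul_right,
    Real.norm_of_nonneg (Real.exp_pos _).le, Real.norm_of_nonneg (Real.sqrt_nonneg _)]
  ring

set_option maxHeartbeats 400000 in
/-- Second and fourth moment bounds for an Ornstein-Uhlenbeck step with Gaussian noise. -/
theorem integral_wnorm_ouStep_le {σ γ h : ℝ} (hσ : 0 < σ) (hγ : 0 ≤ γ) (hh : 0 ≤ h)
    (y : EuclideanSpace ℝ (Fin d) × EuclideanSpace ℝ (Fin d)) :
    (Integrable (fun b ↦ wnorm (σ ^ 2) (ouStep γ h b y) ^ 2) (stdGaussian _) ∧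
      ∫ b, wnorm (σ ^ 2) (ouStep γ h b y) ^ 2 ∂stdGaussian _ ≤
        wnorm (σ ^ 2) y ^ 2 + gaussConst * noiseLevel σ γ h d) ∧
    (Integrable (fun b ↦ wnorm (σ ^ 2) (ouStep γ h b y) ^ 4) (stdGaussian _) ∧
      ∫ b, wnorm (σ ^ 2) (ouStep γ h b y) ^ 4 ∂stdGaussian _ ≤
        (wnorm (σ ^ 2) y ^ 2 + gaussConst * noiseLevel σ γ h d) ^ 2) := by
  have hw := noiseLevel_nonneg σ hγ hh d
  have he1 : Real.exp (-γ * h) ≤ 1 := Real.exp_le_one_iff.2 (by nlinarith [mul_nonneg hγ hh])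
  have he0 := Real.exp_pos (-γ * h)
  have hs1 : Real.exp (-2 * γ * h) ≤ 1 := Real.exp_le_one_iff.2 (by nlinarith [mul_nonneg hγ hh])
  have hs : √(1 - Real.exp (-2 * γ * h)) ^ 2 = 1 - Real.exp (-2 * γ * h) :=
    Real.sq_sqrt (by linarith)
  set m2 := ∫ x, x ^ 2 ∂gaussianReal 0 1 with hm2
  set m4 := ∫ x, x ^ 4 ∂gaussianReal 0 1 with hm4
  have hm2' : 0 ≤ m2 := integral_nonneg fun _ ↦ sq_nonneg _
  have hm4' : 0 ≤ m4 := integral_nonneg fun _ ↦ by positivity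
  have hc : gaussConst = 1 + 5 * m2 + 2 * m4 := rfl
  have hI2 := integrable_norm_pow_stdGaussian (d := d) 2
  have hI4 := integrable_norm_pow_stdGaussian (d := d) 4
  have hE2 := integral_norm_sq_stdGaussian (d := d)
  have hE4 := integral_norm_pow_four_stdGaussian_le (d := d)
  have hIin : Integrable (fun b ↦ inner ℝ y.2 b) (stdGaussian (EuclideanSpace ℝ (Fin d))) :=
    (IsGaussian.integrable_id (μ := stdGaussian (EuclideanSpace ℝ (Fin d)))).const_inner y.2
  have hEin : ∫ b, inner ℝ y.2 b ∂stdGaussian (EuclideanSpace ℝ (Fin d)) = 0 :=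
    integral_strongDual_stdGaussian (innerSL ℝ y.2)
  set e := Real.exp (-γ * h)
  set s := √(1 - Real.exp (-2 * γ * h)) with hs_def
  set S := wnorm (σ ^ 2) y ^ 2 with hS
  have hSeq : S = ‖y.1‖ ^ 2 + (σ ^ 2)⁻¹ * ‖y.2‖ ^ 2 := wnorm_sq σ y
  have hwdef : noiseLevel σ γ h d = (σ ^ 2)⁻¹ * s ^ 2 * d := by rw [noiseLevel, hs]
  set w := noiseLevel σ γ h d
  set p := ‖y.1‖ ^ 2 + (σ ^ 2)⁻¹ * (e * ‖y.2‖) ^ 2 with hp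
  have hpos : 0 < (σ ^ 2)⁻¹ := by positivity
  have hp0 : 0 ≤ p := by positivity
  have hev : (σ ^ 2)⁻¹ * (e * ‖y.2‖) ^ 2 ≤ S := by
    have : e * ‖y.2‖ ≤ 1 * ‖y.2‖ := by gcongr
    rw [one_mul] at this
    have h2 : (σ ^ 2)⁻¹ * (e * ‖y.2‖) ^ 2 ≤ (σ ^ 2)⁻¹ * ‖y.2‖ ^ 2 := by gcongr
    rw [hSeq]; nlinarith [sq_nonneg ‖y.1‖]
  have hpS : p ≤ S := by
    have : e * ‖y.2‖ ≤ 1 * ‖y.2‖ := by gcongr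
    rw [one_mul] at this
    rw [hSeq, hp]; gcongr
  have hS0 : 0 ≤ S := sq_nonneg _
  set a := (σ ^ 2)⁻¹ * s ^ 2 with ha
  have ha0 : 0 ≤ a := by positivity
  set q := 2 * ((σ ^ 2)⁻¹ * e * s) with hq
  have hsq : ∀ b, wnorm (σ ^ 2) (ouStep γ h b y) ^ 2 = p + q * inner ℝ y.2 b + a * ‖b‖ ^ 2 :=
    fun b ↦ by rw [wnorm_sq, wnormSq_ouStep, hq, ha]; ring
  have hfourth : ∀ b, wnorm (σ ^ 2) (ouStep γ h b y) ^ 4 ≤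
      p ^ 2 + (2 * p * q) * inner ℝ y.2 b + (8 * S * a + 2 * p * a) * ‖b‖ ^ 2
        + 2 * a ^ 2 * ‖b‖ ^ 4 := fun b ↦ by
    have h1 : wnorm (σ ^ 2) (ouStep γ h b y) ^ 4 =
      (wnorm (σ ^ 2) (ouStep γ h b y) ^ 2) ^ 2 := by ring
    have h2 : (q * inner ℝ y.2 b) ^ 2 ≤ 4 * S * a * ‖b‖ ^ 2 := by
      have h3 : inner ℝ y.2 b ^ 2 ≤ (‖y.2‖ * ‖b‖) ^ 2 := by
        rw [← sq_abs]
        exact pow_le_pow_left₀ (abs_nonneg _) (abs_real_inner_le_norm _ _) 2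
      calc (q * inner ℝ y.2 b) ^ 2 = q ^ 2 * inner ℝ y.2 b ^ 2 := by ring
        _ ≤ q ^ 2 * (‖y.2‖ * ‖b‖) ^ 2 := by gcongr
        _ = 4 * ((σ ^ 2)⁻¹ * (e * ‖y.2‖) ^ 2) * a * ‖b‖ ^ 2 := by rw [hq, ha]; ring
        _ ≤ _ := by gcongr
    -- The mixed product of the linear and quadratic terms is traded for their squares by completing
    -- a square, leaving only terms whose expectation is known or bounded.
    have h3 : (p + q * inner ℝ y.2 b + a * ‖b‖ ^ 2) ^ 2 =
        p ^ 2 + (2 * p * q) * inner ℝ y.2 b + 2 * p * a * ‖b‖ ^ 2 + 2 * (q * inner ℝ y.2 b) ^ 2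
          + 2 * a ^ 2 * ‖b‖ ^ 4 - (q * inner ℝ y.2 b - a * ‖b‖ ^ 2) ^ 2 := by ring
    rw [h1, hsq, h3]
    linarith [sq_nonneg (q * inner ℝ y.2 b - a * ‖b‖ ^ 2)]
  obtain ⟨hi2, he2⟩ := integral_affine_three hIin hI2 hI4 p q a 0
  obtain ⟨hi4, he4⟩ := integral_affine_three hIin hI2 hI4 (p ^ 2) (2 * p * q)
    (8 * S * a + 2 * p * a) (2 * a ^ 2)
  have hS2 : 0 ≤ m2 * w := by positivity
  refine ⟨⟨?_, ?_⟩, ?_⟩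
  · simpa only [hsq, zero_mul, add_zero] using hi2
  · simp only [zero_mul, add_zero] at he2
    simp only [hsq]
    rw [he2, hEin, hE2, hc]
    have : 0 ≤ m4 * w := by positivity
    have : a * (d * m2) = m2 * w := by rw [hwdef]; ring
    nlinarith
  · have hcont : Continuous fun b ↦ wnorm (σ ^ 2) (ouStep γ h b y) ^ 4 := by
      refine ((continuous_wnorm _).comp ?_).pow 4
      unfold ouStep; fun_prop
    have hI : Integrable (fun b ↦ wnorm (σ ^ 2) (ouStep γ h b y) ^ 4)
        (stdGaussian (EuclideanSpace ℝ (Fin d))) := by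
      refine hi4.mono' hcont.aestronglyMeasurable (ae_of_all _ fun b ↦ ?_)
      rw [Real.norm_of_nonneg (pow_nonneg (wnorm_nonneg _ _) _)]
      exact hfourth b
    refine ⟨hI, (integral_mono hI hi4 hfourth).trans ?_⟩
    rw [he4, hEin, hE2, mul_zero, add_zero]
    calc _ ≤ p ^ 2 + (8 * S * a + 2 * p * a) * (d * m2) + 2 * a ^ 2 * (d ^ 2 * m4) := by gcongr
      _ = p ^ 2 + (8 * S + 2 * p) * (m2 * w) + 2 * m4 * w ^ 2 := by rw [hwdef]; ring
      _ ≤ S ^ 2 + (8 * S + 2 * S) * (m2 * w) + 2 * m4 * w ^ 2 := by gcongr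
      _ ≤ _ := by
        have hc2 : 2 * m4 ≤ gaussConst ^ 2 := two_mul_fourth_moment_le
        -- The coefficient `5` in `gaussConst` is half of the `8 + 2` multiplying `S * (m2 * w)`, to
        -- be matched with the double product of the target square.
        have hc1 : 5 * m2 ≤ gaussConst := by rw [hc]; linarith
        have h1 : 2 * m4 * w ^ 2 ≤ gaussConst ^ 2 * w ^ 2 := by gcongr
        have h2 : 5 * m2 * (S * w) ≤ gaussConst * (S * w) := by gcongr
        have h3 : (S + gaussConst * w) ^ 2 =
          S ^ 2 + 2 * (gaussConst * (S * w)) + gaussConst ^ 2 * w ^ 2 := by ring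
        rw [h3]; linarith

end Gaussian

end

/-! ### The two chains: adaptedness, moments and accumulation of the error -/

section

/-- Extension of a finite initial segment of a sequence by zero. -/
def extendZero {V : Type*} [Zero V] (k : ℕ) (a : Finset.range k → V) (i : ℕ) : V :=
  if hi : i ∈ Finset.range k then a ⟨i, hi⟩ else 0

theorem extendZero_apply {V : Type*} [Zero V] {k i : ℕ} (a : ℕ → V) (hi : i < k) :
    extendZero k (fun j : Finset.range k ↦ a j) i = a i := by
  simp [extendZero, hi]

theorem measurable_extendZero {V : Type*} [Zero V] [MeasurableSpace V] (k : ℕ) :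
    Measurable (extendZero (V := V) k) := by
  refine measurable_pi_lambda _ fun i ↦ ?_
  unfold extendZero
  split_ifs <;> fun_prop

section Chain

variable {E : Type*} [NormedAddCommGroup E] [InnerProductSpace ℝ E]

theorem measurable_ouStep [MeasurableSpace E] [BorelSpace E] [SecondCountableTopology E] (γ h : ℝ) :
    Measurable fun p : E × (E × E) ↦ ouStep γ h p.1 p.2 := by
  unfold ouStep
  fun_prop

variable [CompleteSpace E]

/-- The state at time `k` sees only inputs with index below `k`. With `extendZero` this makes it a
measurable function of a finite past, as the independence arguments require. -/
theorem ukLaChain_congr {U : E → ℝ} {γ h : ℝ} {u u' : ℕ → ℝ} {b b' : ℕ → E} (z : E × E) {k : ℕ}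
    (hu : ∀ i < k, u i = u' i) (hb : ∀ i < k, b i = b' i) :
    ukLaChain U γ h u b z k = ukLaChain U γ h u' b' z k := by
  induction k with
  | zero => rfl
  | succ k ih =>
    rw [ukLaChain, ukLaChain, ih (fun i hi ↦ hu i (by omega)) (fun i hi ↦ hb i (by omega)),
      hu k (by omega), hb k (by omega)]

variable [MeasurableSpace E] [BorelSpace E] [SecondCountableTopology E]

namespace RegularForce

variable {U : E → ℝ} {σ M : ℝ}

theorem measurable_rrknStep (hF : RegularForce U σ M)
    (h : ℝ) :
    Measurable fun p : ℝ × (E × E) ↦ rrknStep U h p.1 p.2 := by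
  have := hF.continuous.measurable
  unfold rrknStep
  fun_prop

theorem measurable_rrknStep_comp (hF : RegularForce U σ M)
    {α : Type*} [MeasurableSpace α] (h : ℝ) {f : α → ℝ}
    {g : α → E × E} (hf : Measurable f) (hg : Measurable g) :
    Measurable fun x ↦ rrknStep U h (f x) (g x) := by
  have h1 := (hF.measurable_rrknStep h).comp (hf.prodMk hg)
  exact h1

theorem measurable_ukLaChain (hF : RegularForce U σ M)
    (γ h : ℝ) (z : E × E) (k : ℕ) :
    Measurable fun p : (ℕ → ℝ) × (ℕ → E) ↦ ukLaChain U γ h p.1 p.2 z k := by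
  induction k with
  | zero => exact measurable_const
  | succ k ih =>
    have h1 : Measurable fun p : (ℕ → ℝ) × (ℕ → E) ↦
        rrknStep U h (p.1 k) (ukLaChain U γ h p.1 p.2 z k) :=
      (hF.measurable_rrknStep h).comp
        (((measurable_pi_apply k).comp measurable_fst).prodMk ih)
    exact (measurable_ouStep γ h).comp (((measurable_pi_apply k).comp measurable_snd).prodMk h1)

theorem measurable_exactChain (hF : RegularForce U σ M)
    (hσ : 0 < σ) (γ : ℝ) {h : ℝ} (hh : 0 ≤ h) (z : E × E) (k : ℕ) :
    Measurable fun b : ℕ → E ↦ exactChain U γ h b z k := by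
  induction k with
  | zero => exact measurable_const
  | succ k ih =>
    exact (measurable_ouStep γ h).comp ((measurable_pi_apply k).prodMk
      ((hF.continuous_hamFlow hσ hh).measurable.comp ih))

theorem measurable_wnorm_rrknStep_sub_hamFlow (hF : RegularForce U σ M)
    (hσ : 0 < σ) {h : ℝ} (hh : 0 ≤ h) :
    Measurable fun p : ((E × E) × (E × E)) × ℝ ↦
      wnorm (σ ^ 2) (rrknStep U h p.2 p.1.1 - hamFlow U h p.1.2) ^ 2 := by
  have h1 : Measurable fun p : ((E × E) × (E × E)) × ℝ ↦ rrknStep U h p.2 p.1.1 :=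
    hF.measurable_rrknStep_comp h measurable_snd (measurable_fst.comp measurable_fst)
  have h2 : Measurable fun p : ((E × E) × (E × E)) × ℝ ↦ hamFlow U h p.1.2 :=
    (hF.continuous_hamFlow hσ hh).measurable.comp (measurable_snd.comp measurable_fst)
  exact ((continuous_wnorm (σ ^ 2)).measurable.comp (h1.sub h2)).pow_const 2

end RegularForce

end Chain

variable {d : ℕ}

/-- The bound `e^{6 σ h k} (‖z‖² + C k w)` on the second moment of the chain after `k` steps. -/
def momentBound (σ γ h : ℝ)
    (z : EuclideanSpace ℝ (Fin d) × EuclideanSpace ℝ (Fin d)) (k : ℕ) : ℝ :=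
  Real.exp (6 * (σ * h) * k) * (wnorm (σ ^ 2) z ^ 2 + k * (gaussConst * noiseLevel σ γ h d))

theorem momentBound_nonneg {σ γ h : ℝ} (hγ : 0 ≤ γ) (hh : 0 ≤ h)
    (z : EuclideanSpace ℝ (Fin d) × EuclideanSpace ℝ (Fin d)) (k : ℕ) :
    0 ≤ momentBound σ γ h z k := by
  have hc := gaussConst_pos
  have hw := noiseLevel_nonneg σ hγ hh d
  unfold momentBound; positivity

theorem momentBound_mono {σ γ h : ℝ} (hσ : 0 ≤ σ) (hγ : 0 ≤ γ) (hh : 0 ≤ h)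
    (z : EuclideanSpace ℝ (Fin d) × EuclideanSpace ℝ (Fin d)) {j k : ℕ} (hjk : j ≤ k) :
    momentBound σ γ h z j ≤ momentBound σ γ h z k := by
  have hc := gaussConst_pos
  have hw := noiseLevel_nonneg σ hγ hh d
  have : (j : ℝ) ≤ k := by exact_mod_cast hjk
  unfold momentBound; gcongr

variable {Ω : Type*} [MeasurableSpace Ω]

/-- The driving noise of the chains: i.i.d. standard Gaussian vectors and, independent of them,
i.i.d. triangular random variables. -/
structure IsDrivingNoise (P : Measure Ω) (ξ : ℕ → Ω → EuclideanSpace ℝ (Fin d))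
    (𝒰 : ℕ → Ω → ℝ) : Prop where
  measurable_gauss : ∀ i, Measurable (ξ i)
  measurable_unif : ∀ i, Measurable (𝒰 i)
  map_gauss : ∀ i, P.map (ξ i) = stdGaussian (EuclideanSpace ℝ (Fin d))
  map_unif : ∀ i, P.map (𝒰 i) = triangular
  iIndep_gauss : iIndepFun ξ P
  iIndep_unif : iIndepFun 𝒰 P
  indep : IndepFun (fun ω i ↦ ξ i ω) (fun ω i ↦ 𝒰 i ω) P

theorem IsDrivingNoise.ae_unif_mem {P : Measure Ω} {ξ : ℕ → Ω → EuclideanSpace ℝ (Fin d)}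
    {𝒰 : ℕ → Ω → ℝ} (hN : IsDrivingNoise P ξ 𝒰) (k : ℕ) : ∀ᵐ ω ∂P, 𝒰 k ω ∈ Ioc (0 : ℝ) 1 := by
  refine ae_of_ae_map (hN.measurable_unif k).aemeasurable ?_
  rw [hN.map_unif]
  exact ae_triangular_mem

variable {P : Measure Ω} {ξ : ℕ → Ω → EuclideanSpace ℝ (Fin d)}
  {𝒰 : ℕ → Ω → ℝ} {U : EuclideanSpace ℝ (Fin d) → ℝ} {σ M : ℝ}

/-- Average over the fresh Gaussian with the incoming state frozen, then over the state. -/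
theorem moments_ouStep [IsProbabilityMeasure P]
    {Y : Ω → EuclideanSpace ℝ (Fin d) × EuclideanSpace ℝ (Fin d)}
    {b : Ω → EuclideanSpace ℝ (Fin d)} (hY : Measurable Y) (hb : Measurable b)
    (hYb : IndepFun Y b P) (hmap : P.map b = stdGaussian (EuclideanSpace ℝ (Fin d)))
    {γ h : ℝ} (hσ : 0 < σ) (hγ : 0 ≤ γ) (hh : 0 ≤ h)
    (h2 : Integrable (fun ω ↦
      wnorm (σ ^ 2) (Y ω) ^ 2 + gaussConst * noiseLevel σ γ h d) P)
    (h4 : Integrable (fun ω ↦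
      (wnorm (σ ^ 2) (Y ω) ^ 2 + gaussConst * noiseLevel σ γ h d) ^ 2) P) :
    (Integrable (fun ω ↦ wnorm (σ ^ 2) (ouStep γ h (b ω) (Y ω)) ^ 2) P ∧
      ∫ ω, wnorm (σ ^ 2) (ouStep γ h (b ω) (Y ω)) ^ 2 ∂P ≤
        ∫ ω, (wnorm (σ ^ 2) (Y ω) ^ 2 + gaussConst * noiseLevel σ γ h d) ∂P) ∧
    (Integrable (fun ω ↦ wnorm (σ ^ 2) (ouStep γ h (b ω) (Y ω)) ^ 4) P ∧
      ∫ ω, wnorm (σ ^ 2) (ouStep γ h (b ω) (Y ω)) ^ 4 ∂P ≤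
        ∫ ω, (wnorm (σ ^ 2) (Y ω) ^ 2 + gaussConst * noiseLevel σ γ h d) ^ 2 ∂P) := by
  have hwm : Measurable (wnorm (σ ^ 2) : EuclideanSpace ℝ (Fin d) × EuclideanSpace ℝ (Fin d) → ℝ) :=
    (continuous_wnorm _).measurable
  have hstep : Measurable fun p : (EuclideanSpace ℝ (Fin d) × EuclideanSpace ℝ (Fin d))
      × EuclideanSpace ℝ (Fin d) ↦ wnorm (σ ^ 2) (ouStep γ h p.2 p.1) :=
    hwm.comp ((measurable_ouStep γ h).comp measurable_swap)
  have hg : Measurable fun y : EuclideanSpace ℝ (Fin d) × EuclideanSpace ℝ (Fin d) ↦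
      wnorm (σ ^ 2) y ^ 2 + gaussConst * noiseLevel σ γ h d := (hwm.pow_const 2).add_const _
  constructor
  · exact integral_comp_le_of_indepFun hY hb hYb
      (f := fun p ↦ wnorm (σ ^ 2) (ouStep γ h p.2 p.1) ^ 2) (hstep.pow_const 2)
      (fun p ↦ sq_nonneg _) hg h2
      (fun y ↦ by rw [hmap]; exact (integral_wnorm_ouStep_le hσ hγ hh y).1.1)
      (fun y ↦ by rw [hmap]; exact (integral_wnorm_ouStep_le hσ hγ hh y).1.2)
  · exact integral_comp_le_of_indepFun hY hb hYb
      (f := fun p ↦ wnorm (σ ^ 2) (ouStep γ h p.2 p.1) ^ 4) (hstep.pow_const 4)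
      (fun p ↦ pow_nonneg (wnorm_nonneg _ _) 4) (hg.pow_const 2) h4
      (fun y ↦ by rw [hmap]; exact (integral_wnorm_ouStep_le hσ hγ hh y).2.1)
      (fun y ↦ by rw [hmap]; exact (integral_wnorm_ouStep_le hσ hγ hh y).2.2)

namespace IsDrivingNoise

theorem measurable_ukLaChain (hN : IsDrivingNoise P ξ 𝒰)
    (hF : RegularForce U σ M) (γ : ℝ) {h : ℝ} (z : EuclideanSpace ℝ (Fin d) × EuclideanSpace ℝ (Fin d)) (k : ℕ) :
    Measurable fun ω ↦ ukLaChain U γ h (fun i ↦ 𝒰 i ω) (fun i ↦ ξ i ω) z k := by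
  have := hN.measurable_gauss
  have := hN.measurable_unif
  exact (hF.measurable_ukLaChain γ h z k).comp
    (f := fun ω ↦ ((fun i ↦ 𝒰 i ω), (fun i ↦ ξ i ω))) (by fun_prop)

theorem measurable_exactChain (hN : IsDrivingNoise P ξ 𝒰)
    (hF : RegularForce U σ M) (γ : ℝ) {h : ℝ} (z : EuclideanSpace ℝ (Fin d) × EuclideanSpace ℝ (Fin d)) (k : ℕ)
    (hσ : 0 < σ) (hh : 0 ≤ h) :
    Measurable fun ω ↦ exactChain U γ h (fun i ↦ ξ i ω) z k := by
  have := hN.measurable_gauss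
  exact (hF.measurable_exactChain hσ γ hh z k).comp (f := fun ω i ↦ ξ i ω) (by fun_prop)

variable [IsProbabilityMeasure P]

/-- The variable `𝒰 k` joins the chain because the randomized step precedes the Gaussian kick within
one iteration. -/
theorem indepFun_gauss (hN : IsDrivingNoise P ξ 𝒰)
    (hF : RegularForce U σ M) (γ : ℝ) {h : ℝ} (z : EuclideanSpace ℝ (Fin d) × EuclideanSpace ℝ (Fin d)) (k : ℕ)
    : IndepFun
    (fun ω ↦ (ukLaChain U γ h (fun i ↦ 𝒰 i ω) (fun i ↦ ξ i ω) z k, 𝒰 k ω)) (ξ k) P := by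
  have := hN.measurable_unif
  have h1 := indepFun_past_present hN.measurable_gauss (C := fun ω i ↦ 𝒰 i ω) (by fun_prop)
    hN.iIndep_gauss hN.indep k
  have h2 : Measurable fun p : (Finset.range k → EuclideanSpace ℝ (Fin d)) × (ℕ → ℝ) ↦
      (ukLaChain U γ h p.2 (extendZero k p.1) z k, p.2 k) :=
    ((hF.measurable_ukLaChain γ h z k).comp (measurable_snd.prodMk
      ((measurable_extendZero k).comp measurable_fst))).prodMk (by fun_prop)
  refine (h1.comp h2 measurable_id).congr (ae_of_all _ fun ω ↦ ?_) (ae_of_all _ fun ω ↦ rfl)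
  simp only [Function.comp_apply]
  rw [← ukLaChain_congr z (fun _ _ ↦ rfl) fun i hi ↦ (extendZero_apply (fun i ↦ ξ i ω) hi).symm]

/-- Both chains appear jointly, since the one-step estimate is applied with both states frozen while
`𝒰 k` is averaged. -/
theorem indepFun_unif (hN : IsDrivingNoise P ξ 𝒰)
    (hF : RegularForce U σ M) (γ : ℝ) {h : ℝ} (z : EuclideanSpace ℝ (Fin d) × EuclideanSpace ℝ (Fin d)) (k : ℕ)
    (hσ : 0 < σ) (hh : 0 ≤ h) : IndepFun
    (fun ω ↦ (ukLaChain U γ h (fun i ↦ 𝒰 i ω) (fun i ↦ ξ i ω) z k,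
      exactChain U γ h (fun i ↦ ξ i ω) z k)) (𝒰 k) P := by
  have := hN.measurable_gauss
  have h1 := indepFun_past_present hN.measurable_unif (C := fun ω i ↦ ξ i ω) (by fun_prop)
    hN.iIndep_unif hN.indep.symm k
  have h2 : Measurable fun p : (Finset.range k → ℝ) × (ℕ → EuclideanSpace ℝ (Fin d)) ↦
      (ukLaChain U γ h (extendZero k p.1) p.2 z k, exactChain U γ h p.2 z k) :=
    ((hF.measurable_ukLaChain γ h z k).comp
      (((measurable_extendZero k).comp measurable_fst).prodMk measurable_snd)).prodMk
      ((hF.measurable_exactChain hσ γ hh z k).comp measurable_snd)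
  refine (h1.comp h2 measurable_id).congr (ae_of_all _ fun ω ↦ ?_) (ae_of_all _ fun ω ↦ rfl)
  simp only [Function.comp_apply]
  rw [← ukLaChain_congr z (fun i hi ↦ (extendZero_apply (fun i ↦ 𝒰 i ω) hi).symm) fun _ _ ↦ rfl]

/-- One step sends the squared norm `S` to at most `A * S` pathwise and then adds noise `m` on
average. The fourth-moment bound closes as the square of the second: if `E S ≤ B` and `E S ^ 2 ≤ B ^
2`, then `E (A * S + m) ^ 2 ≤ (A * B + m) ^ 2`. -/
theorem moments_ukLaChain (hN : IsDrivingNoise P ξ 𝒰)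
    (hF : RegularForce U σ M) (γ : ℝ) {h : ℝ} (z : EuclideanSpace ℝ (Fin d) × EuclideanSpace ℝ (Fin d)) (k : ℕ)
    (hσ : 0 < σ) (hγ : 0 ≤ γ) (hh : 0 < h) (hh' : σ * h ≤ 1 / 2) :
    (Integrable (fun ω ↦
        wnorm (σ ^ 2) (ukLaChain U γ h (fun i ↦ 𝒰 i ω) (fun i ↦ ξ i ω) z k) ^ 2) P ∧
      ∫ ω, wnorm (σ ^ 2) (ukLaChain U γ h (fun i ↦ 𝒰 i ω) (fun i ↦ ξ i ω) z k) ^ 2 ∂P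
        ≤ momentBound σ γ h z k) ∧
    (Integrable (fun ω ↦
        wnorm (σ ^ 2) (ukLaChain U γ h (fun i ↦ 𝒰 i ω) (fun i ↦ ξ i ω) z k) ^ 4) P ∧
      ∫ ω, wnorm (σ ^ 2) (ukLaChain U γ h (fun i ↦ 𝒰 i ω) (fun i ↦ ξ i ω) z k) ^ 4 ∂P
        ≤ momentBound σ γ h z k ^ 2) := by
  have hc := gaussConst_pos
  have hw := noiseLevel_nonneg σ hγ hh.le d
  induction k with
  | zero =>
    simp only [ukLaChain, momentBound, integrable_const, integral_const, probReal_univ, one_smul]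
    simp [← pow_mul]
  | succ k ih =>
    obtain ⟨⟨hi2, he2⟩, hi4, he4⟩ := ih
    set Z := fun ω ↦ ukLaChain U γ h (fun i ↦ 𝒰 i ω) (fun i ↦ ξ i ω) z k with hZ
    set m := gaussConst * noiseLevel σ γ h d with hm
    have hm0 : 0 ≤ m := by positivity
    set A := Real.exp (6 * (σ * h)) with hA
    have hA1 : 1 ≤ A := Real.one_le_exp (by positivity)
    have hwm : Measurable (wnorm (σ ^ 2) :
        EuclideanSpace ℝ (Fin d) × EuclideanSpace ℝ (Fin d) → ℝ) :=
      (continuous_wnorm _).measurable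
    have hZm : Measurable Z := hN.measurable_ukLaChain hF γ z k
    have hUm := hN.measurable_unif k
    have hrm := hF.measurable_rrknStep h
    have hind := hN.indepFun_gauss hF γ (h := h) z k
    -- The new noise term `m` enters with coefficient one, which is at most the exponential
    -- prefactor after `k + 1` steps.
    have hB : A * momentBound σ γ h z k + m ≤ momentBound σ γ h z (k + 1) := by
      have h1 : Real.exp (6 * (σ * h) * (k + 1 : ℕ)) = A * Real.exp (6 * (σ * h) * k) := by
        rw [hA, ← Real.exp_add]; congr 1; push_cast; ring
      have h2 : 1 ≤ A * Real.exp (6 * (σ * h) * k) := by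
        rw [← h1]; exact Real.one_le_exp (by positivity)
      rw [momentBound, momentBound, h1, ← hm]
      push_cast
      nlinarith
    have hB0 : 0 ≤ momentBound σ γ h z k := by unfold momentBound; positivity
    have hgrow : ∀ᵐ ω ∂P, wnorm (σ ^ 2) (rrknStep U h (𝒰 k ω) (Z ω)) ^ 2 + m
        ≤ A * wnorm (σ ^ 2) (Z ω) ^ 2 + m := by
      filter_upwards [hN.ae_unif_mem k] with ω hω
      have h1 := pow_le_pow_left₀ (wnorm_nonneg _ _) (hF.wnorm_rrknStep_le hσ hh hh' hω (Z ω)) 2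
      rw [mul_pow, ← Real.exp_nat_mul] at h1
      have h2 : ((2 : ℕ) : ℝ) * (3 * (σ * h)) = 6 * (σ * h) := by push_cast; ring
      rw [h2] at h1
      linarith
    have hYm : Measurable fun ω ↦ rrknStep U h (𝒰 k ω) (Z ω) :=
      hF.measurable_rrknStep_comp h hUm hZm
    have hg2m : Measurable fun ω ↦ wnorm (σ ^ 2) (rrknStep U h (𝒰 k ω) (Z ω)) ^ 2 + m :=
      ((hwm.comp hYm).pow_const 2).add_const m
    have hg2 : Integrable (fun ω ↦ wnorm (σ ^ 2) (rrknStep U h (𝒰 k ω) (Z ω)) ^ 2 + m) P := by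
      refine ((hi2.const_mul A).add (integrable_const m)).mono'
        hg2m.aestronglyMeasurable ?_
      filter_upwards [hgrow] with ω hω
      rwa [Real.norm_of_nonneg (by positivity)]
    obtain ⟨hq1, hq2⟩ := integral_affine_three hi2 hi4 hi4 (m ^ 2) (2 * A * m) (A ^ 2) 0
    have hgrow4 : ∀ᵐ ω ∂P, (wnorm (σ ^ 2) (rrknStep U h (𝒰 k ω) (Z ω)) ^ 2 + m) ^ 2
        ≤ m ^ 2 + 2 * A * m * wnorm (σ ^ 2) (Z ω) ^ 2 + A ^ 2 * wnorm (σ ^ 2) (Z ω) ^ 4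
          + 0 * wnorm (σ ^ 2) (Z ω) ^ 4 := by
      filter_upwards [hgrow] with ω hω
      refine (pow_le_pow_left₀ (by positivity) hω 2).trans (le_of_eq ?_)
      ring
    have hg4 : Integrable
        (fun ω ↦ (wnorm (σ ^ 2) (rrknStep U h (𝒰 k ω) (Z ω)) ^ 2 + m) ^ 2) P := by
      refine hq1.mono' (hg2m.pow_const 2).aestronglyMeasurable ?_
      filter_upwards [hgrow4] with ω hω
      rwa [Real.norm_of_nonneg (by positivity)]
    obtain ⟨⟨ho1, ho2⟩, ho3, ho4⟩ := moments_ouStep (b := ξ k) hYm (hN.measurable_gauss k)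
      (hind.comp (hrm.comp measurable_swap) measurable_id) (hN.map_gauss k) hσ hγ hh.le hg2 hg4
    refine ⟨⟨ho1, ho2.trans ?_⟩, ho3, ho4.trans ?_⟩
    · refine (integral_mono_ae hg2 ((hi2.const_mul A).add (integrable_const m)) hgrow).trans
        (le_trans ?_ hB)
      simp only [Pi.add_apply]
      rw [integral_add (hi2.const_mul A) (integrable_const m), integral_const_mul]
      simp only [integral_const, probReal_univ, one_smul]
      gcongr
    · refine (integral_mono_ae hg4 hq1 hgrow4).trans
        (le_trans ?_ (pow_le_pow_left₀ (by positivity) hB 2))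
      rw [hq2]
      calc _ ≤ m ^ 2 + 2 * A * m * momentBound σ γ h z k + A ^ 2 * momentBound σ γ h z k ^ 2 := by
            rw [zero_mul, add_zero]; gcongr
        _ = _ := by ring

/-- Discrete Grönwall: the shared Ornstein-Uhlenbeck step drops out, and the one-step mean-square
estimate gives growth `exp (3 σ h)` plus a local term controlled by the moments of the numerical
chain alone. -/
theorem integral_wnorm_ukLaChain_sub_exactChain_sq_le (hN : IsDrivingNoise P ξ 𝒰)
    (hF : RegularForce U σ M) (γ : ℝ) {h : ℝ} (z : EuclideanSpace ℝ (Fin d) × EuclideanSpace ℝ (Fin d)) (k : ℕ)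
    (hσ : 0 < σ) (hM : 0 ≤ M) (hγ : 0 ≤ γ)
    (hh : 0 < h) (hh' : σ * h ≤ 1 / 2) (N : ℕ) (hk : k ≤ N) :
    Integrable (fun ω ↦ wnorm (σ ^ 2) (ukLaChain U γ h (fun i ↦ 𝒰 i ω) (fun i ↦ ξ i ω) z k
      - exactChain U γ h (fun i ↦ ξ i ω) z k) ^ 2) P ∧
    ∫ ω, wnorm (σ ^ 2) (ukLaChain U γ h (fun i ↦ 𝒰 i ω) (fun i ↦ ξ i ω) z k
      - exactChain U γ h (fun i ↦ ξ i ω) z k) ^ 2 ∂P ≤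
      k * Real.exp (3 * (σ * h) * k) * (3 * (σ * h) ^ 6 * momentBound σ γ h z N
        + 9 * (M * σ * h ^ 3) ^ 2 * momentBound σ γ h z N ^ 2) := by
  induction k with
  | zero => simp [ukLaChain, exactChain, wnorm, wnormSq]
  | succ k ih =>
    obtain ⟨hi, he⟩ := ih (by omega)
    obtain ⟨⟨hi2, he2⟩, hi4, he4⟩ := hN.moments_ukLaChain hF γ z k hσ hγ hh hh'
    set Z := fun ω ↦ ukLaChain U γ h (fun i ↦ 𝒰 i ω) (fun i ↦ ξ i ω) z k with hZ
    set Y := fun ω ↦ exactChain U γ h (fun i ↦ ξ i ω) z k with hY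
    -- Moments at all earlier times are replaced by the bound at the fixed horizon `N`, so that the
    -- local term is the same in every step of the induction.
    have hB := momentBound_mono hσ.le hγ hh.le z (show k ≤ N by omega)
    have hB0 := momentBound_nonneg (σ := σ) hγ hh.le z k
    set B := momentBound σ γ h z N
    have hwm : Measurable (wnorm (σ ^ 2) :
        EuclideanSpace ℝ (Fin d) × EuclideanSpace ℝ (Fin d) → ℝ) :=
      (continuous_wnorm _).measurable
    have hZm : Measurable Z := hN.measurable_ukLaChain hF γ z k
    have hYm : Measurable Y := hN.measurable_exactChain hF γ z k hσ hh.le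
    have hXm : Measurable fun ω ↦ (Z ω, Y ω) := hZm.prodMk hYm
    have hind := hN.indepFun_unif hF γ (h := h) z k hσ hh.le
    have hf : Measurable fun p : ((EuclideanSpace ℝ (Fin d) × EuclideanSpace ℝ (Fin d))
        × (EuclideanSpace ℝ (Fin d) × EuclideanSpace ℝ (Fin d))) × ℝ ↦
        wnorm (σ ^ 2) (rrknStep U h p.2 p.1.1 - hamFlow U h p.1.2) ^ 2 :=
      hF.measurable_wnorm_rrknStep_sub_hamFlow hσ hh.le
    obtain ⟨hq1, hq2⟩ := integral_affine_three hi hi2 hi4 0 (Real.exp (3 * (σ * h)))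
      (3 * (σ * h) ^ 6) (9 * (M * σ * h ^ 3) ^ 2)
    have hone := fun x : (EuclideanSpace ℝ (Fin d) × EuclideanSpace ℝ (Fin d))
        × (EuclideanSpace ℝ (Fin d) × EuclideanSpace ℝ (Fin d)) ↦
      hF.integral_wnorm_rrknStep_sub_hamFlow_sq_le hσ hh hh' hM x.1 x.2
    obtain ⟨h1, h2⟩ := integral_comp_le_of_indepFun hXm (hN.measurable_unif k) hind hf
      (fun p ↦ by positivity)
      (g := fun x ↦ 0 + Real.exp (3 * (σ * h)) * wnorm (σ ^ 2) (x.1 - x.2) ^ 2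
        + 3 * (σ * h) ^ 6 * wnorm (σ ^ 2) x.1 ^ 2
        + 9 * (M * σ * h ^ 3) ^ 2 * wnorm (σ ^ 2) x.1 ^ 4) (by fun_prop) hq1
      (fun x ↦ by rw [hN.map_unif]; exact (hone x).1)
      (fun x ↦ by rw [hN.map_unif]; refine (hone x).2.trans (le_of_eq ?_); ring)
    have hle : ∀ ω, wnorm (σ ^ 2)
        (ukLaChain U γ h (fun i ↦ 𝒰 i ω) (fun i ↦ ξ i ω) z (k + 1)
          - exactChain U γ h (fun i ↦ ξ i ω) z (k + 1)) ^ 2 ≤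
        wnorm (σ ^ 2) (rrknStep U h (𝒰 k ω) (Z ω) - hamFlow U h (Y ω)) ^ 2 := fun ω ↦
      pow_le_pow_left₀ (wnorm_nonneg _ _) (wnorm_ouStep_sub_le σ hγ hh.le _ _ _) 2
    have hI : Integrable (fun ω ↦ wnorm (σ ^ 2)
        (ukLaChain U γ h (fun i ↦ 𝒰 i ω) (fun i ↦ ξ i ω) z (k + 1)
          - exactChain U γ h (fun i ↦ ξ i ω) z (k + 1)) ^ 2) P := by
      refine h1.mono' ?_ (ae_of_all _ fun ω ↦ ?_)
      · exact ((hwm.comp ((hN.measurable_ukLaChain hF γ z (k + 1)).sub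
          (hN.measurable_exactChain hF γ z (k + 1) hσ hh.le))).pow_const 2).aestronglyMeasurable
      · rw [Real.norm_of_nonneg (sq_nonneg _)]
        exact hle ω
    refine ⟨hI, (integral_mono hI h1 hle).trans (h2.trans ?_)⟩
    rw [hq2, zero_add]
    set ℓ := 3 * (σ * h) ^ 6 * B + 9 * (M * σ * h ^ 3) ^ 2 * B ^ 2 with hℓ
    have hℓ0 : 0 ≤ ℓ := by have := hB0.trans hB; positivity
    have hE : Real.exp (3 * (σ * h) * (k + 1 : ℕ)) =
        Real.exp (3 * (σ * h)) * Real.exp (3 * (σ * h) * k) := by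
      rw [← Real.exp_add]; congr 1; push_cast; ring
    have hE1 : 1 ≤ Real.exp (3 * (σ * h) * (k + 1 : ℕ)) := Real.one_le_exp (by positivity)
    calc _ ≤ Real.exp (3 * (σ * h)) * (k * Real.exp (3 * (σ * h) * k) * ℓ)
          + 3 * (σ * h) ^ 6 * B + 9 * (M * σ * h ^ 3) ^ 2 * B ^ 2 := by
          gcongr
          · exact he2.trans hB
          · exact he4.trans (by gcongr)
      _ = Real.exp (3 * (σ * h) * (k + 1 : ℕ)) * k * ℓ + 1 * ℓ := by rw [hE, hℓ]; ring
      _ ≤ Real.exp (3 * (σ * h) * (k + 1 : ℕ)) * k * ℓ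
          + Real.exp (3 * (σ * h) * (k + 1 : ℕ)) * ℓ := by gcongr
      _ = _ := by push_cast; ring

end IsDrivingNoise

end

/-! ### Matching the accumulated error with the stated constants -/

set_option maxHeartbeats 800000 in
/-- The elementary inequality that turns the accumulated mean-square error into the
root-mean-square bound. -/
theorem rpow_half_error_le {D σ M h T γ δ n c w : ℝ} {k : ℕ} (hσ : 0 < σ) (hM : 0 ≤ M)
    (hh : 0 < h) (hT : 0 < T) (hγ : 0 < γ) (hδ : 0 ≤ δ) (hn : 0 ≤ n) (hc : 0 < c) (hw0 : 0 ≤ w)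
    (hσT : σ * T ≤ 1 / 2) (hk : k * h ≤ T) (hw : w ≤ (σ ^ 2)⁻¹ * (2 * γ * h) * δ)
    (hD : D ≤ k * Real.exp (3 * (σ * h) * k) *
      (3 * (σ * h) ^ 6 * (Real.exp (6 * (σ * h) * k) * (n ^ 2 + k * (c * w)))
        + 9 * (M * σ * h ^ 3) ^ 2 * (Real.exp (6 * (σ * h) * k) * (n ^ 2 + k * (c * w))) ^ 2)) :
    D ^ (1 / 2 : ℝ) ≤ 3 / 2 * Real.exp (5 / 2) * ((σ ^ 2) ^ (1 / 2 : ℝ) * h) ^ (5 / 2 : ℝ) *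
        (n + γ ^ (1 / 2 : ℝ) * (σ ^ 2) ^ (-(1 / 2) : ℝ) * δ ^ (1 / 2 : ℝ)
          * (2 * c) ^ (1 / 2 : ℝ) * √((Real.exp (2 * γ * T) - 1) / (2 * γ)))
      + 14 * √2 * Real.exp (5 / 2) * (σ ^ 2) ^ (1 / 2 : ℝ)
          * (M * h ^ 3 / ((σ ^ 2) ^ (1 / 4 : ℝ) * h ^ (1 / 2 : ℝ))) *
        (n ^ 2 + 2 * γ * (σ ^ 2)⁻¹ * δ * (c ^ 2) ^ (1 / 2 : ℝ) * T ^ (1 / 2 : ℝ)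
          * √((Real.exp (4 * γ * T) - 1) / (4 * γ))) := by
  have hσ2 : (σ ^ 2) ^ (1 / 2 : ℝ) = σ := by
    rw [← Real.sqrt_eq_rpow, Real.sqrt_sq hσ.le]
  have hσ4 : ((σ ^ 2) ^ (1 / 4 : ℝ)) ^ 2 = σ := by
    rw [← Real.rpow_natCast, ← Real.rpow_mul (by positivity)]
    norm_num [hσ2]
  have hσm : (σ ^ 2) ^ (-(1 / 2) : ℝ) = σ⁻¹ := by
    rw [Real.rpow_neg (by positivity), hσ2]
  have hc2 : (c ^ 2) ^ (1 / 2 : ℝ) = c := by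
    rw [← Real.sqrt_eq_rpow, Real.sqrt_sq hc.le]
  rw [hσ2, hσm, hc2]
  simp only [← Real.sqrt_eq_rpow]
  -- The exponential quotients in the target are only needed as upper bounds for `T`.
  have hexp : ∀ a : ℝ, 0 < a → T ≤ (Real.exp (a * T) - 1) / a := fun a ha ↦ by
    rw [le_div_iff₀ ha]; linarith [Real.add_one_le_exp (a * T)]
  -- `Q` bounds the second moment up to `exp 3`. It is compared with `X ^ 2` for the Lipschitz part
  -- of the error and with `Y` for the Hessian part, where `Q ^ 2` occurs.
  set Q := n ^ 2 + 2 * γ * (σ ^ 2)⁻¹ * δ * c * T with hQ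
  have hQ0 : 0 ≤ Q := by positivity
  set X := n + √γ * σ⁻¹ * √δ * √(2 * c) * √((Real.exp (2 * γ * T) - 1) / (2 * γ)) with hX
  set Y := n ^ 2 + 2 * γ * (σ ^ 2)⁻¹ * δ * c * √T * √((Real.exp (4 * γ * T) - 1) / (4 * γ)) with hY
  have hX0 : 0 ≤ X := by positivity
  have hY0 : 0 ≤ Y := by positivity
  have hQX : Q ≤ X ^ 2 := by
    have h1 := hexp (2 * γ) (by positivity)
    set r := √γ * σ⁻¹ * √δ * √(2 * c) * √((Real.exp (2 * γ * T) - 1) / (2 * γ)) with hr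
    have hr0 : 0 ≤ r := by positivity
    have h2 : r ^ 2 = γ * (σ ^ 2)⁻¹ * δ * (2 * c) * ((Real.exp (2 * γ * T) - 1) / (2 * γ)) := by
      rw [hr]
      simp only [mul_pow]
      rw [Real.sq_sqrt hγ.le, Real.sq_sqrt hδ, Real.sq_sqrt (by positivity),
        Real.sq_sqrt (hT.le.trans h1), inv_pow]
    have h3 : γ * (σ ^ 2)⁻¹ * δ * (2 * c) * T ≤ r ^ 2 := by rw [h2]; gcongr
    rw [hQ, hX]
    nlinarith [mul_nonneg hn hr0]
  have hQY : Q ≤ Y := by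
    have h1 : √T ≤ √((Real.exp (4 * γ * T) - 1) / (4 * γ)) :=
      Real.sqrt_le_sqrt (hexp (4 * γ) (by positivity))
    calc Q = n ^ 2 + 2 * γ * (σ ^ 2)⁻¹ * δ * c * √T * √T := by
          rw [hQ, mul_assoc _ (√T), Real.mul_self_sqrt hT.le]
      _ ≤ Y := by rw [hY]; gcongr
  have hkη : σ * h * k ≤ 1 / 2 := by
    calc σ * h * k = σ * (k * h) := by ring
      _ ≤ σ * T := by gcongr
      _ ≤ _ := hσT
  have hB : Real.exp (6 * (σ * h) * k) * (n ^ 2 + k * (c * w)) ≤ Real.exp 3 * Q := by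
    have h1 : k * (c * w) ≤ 2 * γ * (σ ^ 2)⁻¹ * δ * c * T := by
      calc k * (c * w) ≤ k * (c * ((σ ^ 2)⁻¹ * (2 * γ * h) * δ)) := by gcongr
        _ = 2 * γ * (σ ^ 2)⁻¹ * δ * c * (k * h) := by ring
        _ ≤ _ := by gcongr
    rw [hQ]
    gcongr
    linarith
  have hE : Real.exp (3 * (σ * h) * k) ≤ Real.exp (3 / 2) := Real.exp_le_exp.2 (by linarith)
  set B := Real.exp (6 * (σ * h) * k) * (n ^ 2 + k * (c * w)) with hB_def
  have hB0 : 0 ≤ B := by positivity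
  have hBX : B ≤ Real.exp 3 * X ^ 2 := hB.trans (by gcongr)
  have hBY : B ≤ Real.exp 3 * Y := hB.trans (by gcongr)
  set t := 3 / 2 * Real.exp (5 / 2) * (σ * h) ^ (5 / 2 : ℝ) * X with ht
  set s := 14 * √2 * Real.exp (5 / 2) * σ * (M * h ^ 3 / ((σ ^ 2) ^ (1 / 4 : ℝ) * √h)) * Y with hs
  have ht0 : 0 ≤ t := by positivity
  have hs0 : 0 ≤ s := by positivity
  have he5 : Real.exp (5 / 2) ^ 2 = Real.exp 5 := by rw [← Real.exp_nat_mul]; norm_num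
  have ht2 : t ^ 2 = 9 / 4 * Real.exp 5 * ((σ * h) ^ 5 * X ^ 2) := by
    have h1 : ((σ * h) ^ (5 / 2 : ℝ)) ^ 2 = (σ * h) ^ 5 := by
      rw [← Real.rpow_natCast, ← Real.rpow_mul (by positivity), ← Real.rpow_natCast]
      norm_num
    rw [ht, mul_pow, mul_pow, mul_pow, he5, h1]; ring
  have hs2 : s ^ 2 = 392 * Real.exp 5 * (M ^ 2 * σ * h ^ 5 * Y ^ 2) := by
    rw [hs]
    simp only [mul_pow, div_pow]
    rw [he5, hσ4, Real.sq_sqrt hh.le, Real.sq_sqrt (by norm_num : (0 : ℝ) ≤ 2)]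
    field_simp
    ring
  -- It suffices to bound `D` by the sum of squares, since `t ^ 2 + s ^ 2 ≤ (t + s) ^ 2`.
  have hDts : D ≤ t ^ 2 + s ^ 2 := by
    rw [ht2, hs2]
    have h45 : Real.exp (3 / 2) * Real.exp 3 ≤ Real.exp 5 := by
      rw [← Real.exp_add]; exact Real.exp_le_exp.2 (by norm_num)
    have h75 : Real.exp (3 / 2) * Real.exp 3 ^ 2 ≤ 21 * Real.exp 5 := by
      have h1 : Real.exp 3 ≤ 21 := by
        have h2 : Real.exp 3 = Real.exp 1 ^ 3 := by rw [← Real.exp_nat_mul]; norm_num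
        rw [h2]
        calc Real.exp 1 ^ 3 ≤ (2.7182818286 : ℝ) ^ 3 := by gcongr; exact Real.exp_one_lt_d9.le
          _ ≤ 21 := by norm_num
      calc _ = Real.exp 3 * (Real.exp (3 / 2) * Real.exp 3) := by ring
        _ ≤ 21 * Real.exp 5 := by gcongr
    calc D ≤ _ := hD
      _ ≤ k * Real.exp (3 / 2) * (3 * (σ * h) ^ 6 * (Real.exp 3 * X ^ 2)
          + 9 * (M * σ * h ^ 3) ^ 2 * (Real.exp 3 * Y) ^ 2) := by gcongr
      -- The number of steps consumes one factor `σ h` of the local error, `σ * h * k` being at most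
      -- `1 / 2`. The order `h ^ 6` thus becomes `h ^ 5`.
      _ = (σ * h * k) * (3 * (Real.exp (3 / 2) * Real.exp 3) * ((σ * h) ^ 5 * X ^ 2)
          + 9 * (Real.exp (3 / 2) * Real.exp 3 ^ 2) * (M ^ 2 * σ * h ^ 5 * Y ^ 2)) := by ring
      _ ≤ (1 / 2) * (3 * Real.exp 5 * ((σ * h) ^ 5 * X ^ 2)
          + 9 * (21 * Real.exp 5) * (M ^ 2 * σ * h ^ 5 * Y ^ 2)) := by gcongr
      _ ≤ _ := by
        have h1 : 0 ≤ Real.exp 5 * ((σ * h) ^ 5 * X ^ 2) := by positivity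
        have h2 : 0 ≤ Real.exp 5 * (M ^ 2 * σ * h ^ 5 * Y ^ 2) := by positivity
        linarith
  rw [Real.sqrt_le_left (by positivity)]
  nlinarith [mul_nonneg ht0 hs0]

end KineticLangevin

end

/-! ### The main theorem -/

open KineticLangevin in
theorem theorem2 :
    ∃ C₁ C₂ : ℝ, 0 < C₁ ∧ 0 < C₂ ∧
      ∀ (d : ℕ) (U : EuclideanSpace ℝ (Fin d) → ℝ) (L LH : ℝ),
        -- the assumptions on the potential
        ContDiff ℝ 2 U →
        U 0 = 0 → (∀ x, U 0 ≤ U x) →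
        0 < L → (∀ x y, ‖gradient U x - gradient U y‖ ≤ L * ‖x - y‖) →
        0 ≤ LH →
        (∀ x y, ‖fderiv ℝ (gradient U) x - fderiv ℝ (gradient U) y‖ ≤ LH * ‖x - y‖) →
      -- friction, duration and step size
      ∀ γ T h : ℝ, 0 < γ → 0 < T → L * T ^ 2 ≤ 1 / 4 → 0 < h → (∃ N : ℤ, T / h = N) →
      -- the driving noise
      ∀ {Ω : Type*} [MeasurableSpace Ω] (P : Measure Ω) [IsProbabilityMeasure P]
        (ξ : ℕ → Ω → EuclideanSpace ℝ (Fin d)) (𝒰 : ℕ → Ω → ℝ),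
        (∀ i, Measurable (ξ i)) → (∀ i, Measurable (𝒰 i)) →
        (∀ i, P.map (ξ i) = stdGaussian (EuclideanSpace ℝ (Fin d))) →
        (∀ i, P.map (𝒰 i) = triangular) →
        iIndepFun ξ P → iIndepFun 𝒰 P →
        IndepFun (fun ω i => ξ i ω) (fun ω i => 𝒰 i ω) P →
      ∀ (z : EuclideanSpace ℝ (Fin d) × EuclideanSpace ℝ (Fin d)) (k : ℕ), k * h ≤ T →
        Integrable (fun ω =>
          wnorm L (ukLaChain U γ h (fun i => 𝒰 i ω) (fun i => ξ i ω) z k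
            - exactChain U γ h (fun i => ξ i ω) z k) ^ 2) P ∧
        (∫ ω, wnorm L (ukLaChain U γ h (fun i => 𝒰 i ω) (fun i => ξ i ω) z k
            - exactChain U γ h (fun i => ξ i ω) z k) ^ 2 ∂P) ^ (1 / 2 : ℝ)
          ≤ 3 / 2 * Real.exp (5 / 2) * (L ^ (1 / 2 : ℝ) * h) ^ (5 / 2 : ℝ) *
              (wnorm L z + γ ^ (1 / 2 : ℝ) * L ^ (-(1 / 2) : ℝ) * (d : ℝ) ^ (1 / 2 : ℝ)
                * C₁ ^ (1 / 2 : ℝ) * Real.sqrt ((Real.exp (2 * γ * T) - 1) / (2 * γ)))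
            + 14 * Real.sqrt 2 * Real.exp (5 / 2) * L ^ (1 / 2 : ℝ)
                * (LH * h ^ 3 / (L ^ (1 / 4 : ℝ) * h ^ (1 / 2 : ℝ))) *
              (wnorm L z ^ 2 + 2 * γ * L⁻¹ * d * C₂ ^ (1 / 2 : ℝ) * T ^ (1 / 2 : ℝ)
                * Real.sqrt ((Real.exp (4 * γ * T) - 1) / (4 * γ))) := by
  have hC := gaussConst_pos
  -- The factor `2` in `C₁` comes from `1 - exp (-2 γ h) ≤ 2 γ h`; `C₂` is a square because the
  -- statement takes its square root.
  refine ⟨2 * gaussConst, gaussConst ^ 2, by positivity, by positivity, ?_⟩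
  intro d U L LH hU _ hmin hL hlip hLH hH γ T h hγ hT hLT hh hTh Ω _ P _ ξ 𝒰 hξm hUm hξ hU𝒰
    hξi hUi hind z k hk
  have hF := RegularForce.of_potential hL hU hmin hlip hH
  have hσ : 0 < √L := Real.sqrt_pos.2 hL
  have hLσ : L = √L ^ 2 := (Real.sq_sqrt hL.le).symm
  have hN : IsDrivingNoise P ξ 𝒰 := ⟨hξm, hUm, hξ, hU𝒰, hξi, hUi, hind⟩
  have hσT : √L * T ≤ 1 / 2 := by
    rw [← Real.sqrt_sq hT.le, ← Real.sqrt_mul hL.le]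
    exact Real.sqrt_le_iff.2 ⟨by norm_num, by linarith⟩
  -- A positive integer `T / h` is at least one; this gives `√L * h ≤ 1 / 2`, the smallness needed
  -- by the local estimates.
  have hhT : h ≤ T := by
    obtain ⟨N, hN⟩ := hTh
    have h1 : (0 : ℝ) < N := by rw [← hN]; positivity
    have h2 : (1 : ℝ) ≤ N := by exact_mod_cast (by exact_mod_cast h1 : (0 : ℤ) < N)
    rwa [← hN, one_le_div hh] at h2
  have hσh : √L * h ≤ 1 / 2 := le_trans (by gcongr) hσT
  generalize √L = σ at *
  subst hLσ
  obtain ⟨h1, h2⟩ := hN.integral_wnorm_ukLaChain_sub_exactChain_sq_le hF γ z k hσ hLH hγ.le hh hσh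
    k le_rfl
  exact ⟨h1, rpow_half_error_le hσ hLH hh hT hγ d.cast_nonneg (wnorm_nonneg _ _) hC
    (noiseLevel_nonneg σ hγ.le hh.le d) hσT hk (noiseLevel_le σ γ h d)
    h2⟩
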